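/- **Conventions.** Let $z\in\mathbb{C}\setminus(-\infty,1]$ and take all phases $\arg(z\pm1)\in(-\pi,\pi)$; in particular $(z^2-1)^{a}=(z-1)^a(z+1)^a$ and $\left(\frac{z-1}{z+1}\right)^{a}=(z-1)^a/(z+1)^a$ with these phases. Let $m\ge 0$ be an integer, $\psi=\Gamma'/\Gamma$, and $\nu\in\mathbb{C}$. *Contours.* $\mathscr{C}^{(+)}$ is any closed piecewise $C^1$ path in the $t$-plane which has winding number $+1$ about $t=1$ and about $t=z$ and does not meet the half-line $t=-\eta$ $(1\le\eta<\infty)$ nor the circular arc $t=\frac{1+\eta z}{z+\eta}$ $(1\le\eta<\infty)$ joining $1$ and $z$ (end point $z$ included). $\mathscr{C}'^{(+)}$ is any closed piecewise $C^1$ path in the $u$-plane which has winding number $+1$ about $u=1$ and about $u=z$ and does not meet the half-line $u=-1+2\frac{z+1}{1-\eta}$ $(1<\eta<\infty)$ (end point $-1$ included) nor the segment $u=1+2\frac{z-1}{1+\eta}$ $(1\le\eta<\infty)$ from $z$ to $1$ (end point $1$ included). These are the two contours that correspond to each other under $u=-1+2\frac{z+1}{t+1}$, up to deformation. *Branches.*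 The integrands over $\mathscr{C}^{(+)}$ are single-valued in the $t$-plane with its two cuts, with $\arg(t\pm1)=0$ and $|\arg(t-z)|<\pi$ for real $t$ to the right of $1$ (and of $z$ if $z$ is real); so $\ln\frac{t+1}{2}$ is the principal logarithm, and $\frac{(t^2-1)^{\nu}}{(t-z)^{\nu+k+1}}=(t+1)^{\nu}\left(\frac{t-1}{t-z}\right)^{\nu}(t-z)^{-k-1}$ for $k\in\mathbb{Z}$, where $(t+1)^\nu$ is the principal power and $\left(\frac{t-1}{t-z}\right)^\nu$ is the branch holomorphic off the arc that tends to $1$ as $t\to\infty$. The integrands over $\mathscr{C}'^{(+)}$ are single-valued in the $u$-plane with its two cuts: $\ln(u+1)=\operatorname{Ln}\frac{u+1}{z+1}+\operatorname{Ln}(z+1)$ with principal logarithms $\operatorname{Ln}$, $\ln\frac{u+1}{2}=\ln(u+1)-\ln2$, and for $k\in\mathbb{Z}$ $$\frac{(u-1)^{\nu-k}(u+1)^{\nu+k}}{(u-z)^{\nu+1}}=(u+1)^{\nu}\left(\frac{u-1}{u-z}\right)^{\nu}\left(\frac{u+1}{u-1}\right)^{k}\frac{1}{u-z},$$ where $(u+1)^\nu=\mathrm{e}^{\nu\ln(u+1)}$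 and $\left(\frac{u-1}{u-z}\right)^{\nu}$ is the principal power. *The function.* The associated Legendre function of the first kind of degree $\nu$ and order $\pm m$ is $$P_\nu^{\pm m}(z)=\frac{\Gamma(\nu\pm m+1)}{\Gamma(\nu+1)}\frac{1}{2^{\nu+1}\pi\mathrm{i}}(z^2-1)^{\pm m/2}\oint_{\mathscr{C}^{(+)}}\frac{(t^2-1)^{\nu}}{(t-z)^{\nu\pm m+1}}\,\mathrm{d}t ,$$ where at a degree for which $\nu+1$ or $\nu\pm m+1$ is a pole of $\Gamma$ the right-hand side is replaced by its limit with respect to $\nu$. **Statement.** For every $\nu\in\mathbb{C}$, every integer $m\ge0$ and either choice of sign, $P_\nu^{\pm m}(z)$ is complex differentiable with respect to $\nu$, and for all contours $\mathscr{C}^{(+)}$ and $\mathscr{C}'^{(+)}$ as above $$\begin{aligned}\frac{\partial P_{\nu}^{\pm m}(z)}{\partial\nu}={}&-P_{\nu}^{\pm m}(z)\ln\frac{z+1}{2}+[\psi(\nu\pm m+1)-\psi(\nu+1)]P_{\nu}^{\pm m}(z)\\&+\frac{\Gamma(\nu\pm m+1)}{\Gamma(\nu+1)}\frac{1}{2^{\nu+1}\pi\mathrm{i}}(z^{2}-1)^{\pm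 m/2}\oint_{\mathscr{C}^{(+)}}\frac{(t^{2}-1)^{\nu}}{(t-z)^{\nu\pm m+1}}\ln\frac{t+1}{2}\,\mathrm{d}t\\&+\frac{\Gamma(\nu\pm m+1)}{\Gamma(\nu+1)}\frac{1}{2^{\nu+1}\pi\mathrm{i}}(z^{2}-1)^{\mp m/2}\oint_{\mathscr{C}^{(+)}}\frac{(t^{2}-1)^{\nu}}{(t-z)^{\nu\mp m+1}}\ln\frac{t+1}{2}\,\mathrm{d}t\end{aligned}\tag{1}$$ and $$\begin{aligned}\frac{\partial P_{\nu}^{\pm m}(z)}{\partial\nu}={}&-P_{\nu}^{\pm m}(z)\ln\frac{z+1}{2}+[\psi(\nu+1)-\psi(\nu\mp m+1)]P_{\nu}^{\pm m}(z)\\&+\frac{\Gamma(\nu+1)}{\Gamma(\nu\mp m+1)}\frac{1}{2^{\nu+1}\pi\mathrm{i}}\left(\frac{z-1}{z+1}\right)^{\pm m/2}\oint_{\mathscr{C}'^{(+)}}\frac{(u-1)^{\nu\mp m}(u+1)^{\nu\pm m}}{(u-z)^{\nu+1}}\ln\frac{u+1}{2}\,\mathrm{d}u\\&+\frac{\Gamma(\nu+1)}{\Gamma(\nu\mp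 m+1)}\frac{1}{2^{\nu+1}\pi\mathrm{i}}\left(\frac{z+1}{z-1}\right)^{\pm m/2}\oint_{\mathscr{C}'^{(+)}}\frac{(u-1)^{\nu\pm m}(u+1)^{\nu\mp m}}{(u-z)^{\nu+1}}\ln\frac{u+1}{2}\,\mathrm{d}u .\end{aligned}\tag{2}$$ Here (1) holds literally when neither $\nu+1$ nor $\nu\pm m+1$ is a pole of $\Gamma$, and (2) holds literally when neither $\nu+1$ nor $\nu\mp m+1$ is a pole of $\Gamma$. At every $\nu\in\mathbb{C}$, the exceptional degrees included, the right-hand sides of (1) and of (2) at $w\neq\nu$ tend to $\partial P_\nu^{\pm m}(z)/\partial\nu$ as $w\to\nu$. -/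

import Mathlib

open Filter Topology Set

noncomputable section

namespace Legendre

/-! ### Closed contours and contour integrals -/

/-- The contour integral `∮_C f(t) dt` along a closed path `C`. -/
def contourIntegral {p : ℂ} (C : Path p p) (f : ℂ → ℂ) : ℂ :=
  curveIntegral (fun t => ContinuousLinearMap.toSpanSingleton ℂ (f t)) C

/-- A closed path is piecewise continuously differentiable: there are finitely many break points
such that the path is `C¹` (one-sidedly at the ends) on every closed parameter interval with no
break point in its interior. -/
def IsPiecewiseC1 {p : ℂ} (C : Path p p) : Prop :=
  ∃ S : Finset ℝ, ∀ a b : ℝ, 0 ≤ a → a < b → b ≤ 1 → (∀ s ∈ S, s ∉ Ioo a b) →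
    ContDiffOn ℝ 1 C.extend (Icc a b)

/-- `C` is a piecewise `C¹` circuit which does not meet the set `K` and surrounds each of the
points `a` and `b` once in the counter-clockwise sense (winding number `+1`). -/
structure Surrounds {p : ℂ} (C : Path p p) (K : Set ℂ) (a b : ℂ) : Prop where
  piecewiseC1 : IsPiecewiseC1 C
  avoids : ∀ s, C s ∉ K
  winding_left : contourIntegral C (fun t => 1 / (t - a)) = 2 * Real.pi * Complex.I
  winding_right : contourIntegral C (fun t => 1 / (t - b)) = 2 * Real.pi * Complex.I

/-! ### The cuts -/

/-- The half-line `t = -η`, `1 ≤ η < ∞`. -/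
def halfLineCut : Set ℂ := {t | ∃ η : ℝ, 1 ≤ η ∧ t = -(η : ℂ)}

/-- The circular arc `t = (1 + η z) / (z + η)`, `1 ≤ η < ∞`, from `t = 1` (`η = 1`) to `t = z`
(`η → ∞`), with the end point `z` included. -/
def arcCut (z : ℂ) : Set ℂ := {t | ∃ η : ℝ, 1 ≤ η ∧ t = (1 + η * z) / (z + η)} ∪ {z}

/-- The half-line `u = -1 + 2 (z + 1) / (1 - η)`, `1 < η < ∞`, from infinity (`η → 1`) to `u = -1`
(`η → ∞`), with the end point `-1` included. -/
def rayCut (z : ℂ) : Set ℂ := {u | ∃ η : ℝ, 1 < η ∧ u = -1 + 2 * (z + 1) / (1 - η)} ∪ {-1}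

/-- The segment `u = 1 + 2 (z - 1) / (1 + η)`, `1 ≤ η < ∞`, from `u = z` (`η = 1`) to `u = 1`
(`η → ∞`), with the end point `1` included. -/
def segmentCut (z : ℂ) : Set ℂ := {u | ∃ η : ℝ, 1 ≤ η ∧ u = 1 + 2 * (z - 1) / (1 + η)} ∪ {1}

/-- The contours `𝒞⁽⁺⁾` in the `t`-plane. -/
def IsContour (z : ℂ) {p : ℂ} (C : Path p p) : Prop :=
  Surrounds C (halfLineCut ∪ arcCut z) 1 z

/-- The contours `𝒞'⁽⁺⁾` in the `u`-plane. -/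
def IsContour' (z : ℂ) {p : ℂ} (C : Path p p) : Prop :=
  Surrounds C (rayCut z ∪ segmentCut z) 1 z

/-! ### The single-valued integrands -/

/-- The branch of `ln ((t - 1) / (t - z))` which is holomorphic off the arc `arcCut z` and tends to
`0` as `t → ∞`. The arc is exactly the set where `(z + 1) (t - 1) / (t - z)` is a real number `≤ 0`,
or infinite. For real `t > 1` (and `t > z` if `z` is real) this is `ln (t - 1) - ln (t - z)` with
`arg (t - 1) = 0` and `|arg (t - z)| < π`. -/
def arcLog (z t : ℂ) : ℂ :=
  Complex.log ((z + 1) * (t - 1) / (t - z)) - Complex.log (z + 1)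

/-- The integrand `(t ^ 2 - 1) ^ ν / (t - z) ^ (ν + μ + 1)`, made single-valued by the two cuts
`halfLineCut` and `arcCut z`, with phases `arg (t ± 1) = 0`, `|arg (t - z)| < π` on the real axis
to the right of `1` (and of `z`, if `z` is real). It is written as
`(t + 1) ^ ν * ((t - 1) / (t - z)) ^ ν * (t - z) ^ (-(μ + 1))`. -/
def schlafliKernel (ν : ℂ) (μ : ℤ) (z t : ℂ) : ℂ :=
  Complex.exp (ν * (Complex.log (t + 1) + arcLog z t)) * (t - z) ^ (-(μ + 1))

/-- The branch of `ln (u + 1)` which is holomorphic off `rayCut z` and is such that `arg (u + 1)`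
equals `arg (z + 1)`, in `(-π, π)`, on the half-line from `-1` through `z`. -/
def rayLog (z u : ℂ) : ℂ :=
  Complex.log ((u + 1) / (z + 1)) + Complex.log (z + 1)

/-- The integrand `(u - 1) ^ (ν - μ) * (u + 1) ^ (ν + μ) / (u - z) ^ (ν + 1)`, made single-valued by
the two cuts `rayCut z` and `segmentCut z`. It is written as
`(u + 1) ^ ν * ((u - 1) / (u - z)) ^ ν * ((u + 1) / (u - 1)) ^ μ / (u - z)`, where `(u + 1) ^ ν` is
taken with `rayLog`, and the second power is the principal one (`segmentCut z` is exactly the set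
where `(u - 1) / (u - z)` is a real number `≤ 0`, or infinite). -/
def schendelKernel (ν : ℂ) (μ : ℤ) (z u : ℂ) : ℂ :=
  Complex.exp (ν * (rayLog z u + Complex.log ((u - 1) / (u - z)))) *
    ((u + 1) / (u - 1)) ^ μ / (u - z)

/-! ### The associated Legendre function of the first kind -/

/-- `s` is a pole of the gamma function (and of the digamma function). -/
def IsGammaPole (s : ℂ) : Prop := ∃ n : ℕ, s = -(n : ℂ)

/-- `(z ^ 2 - 1) ^ a`, with the phases `-π < arg (z ± 1) < π`. -/
def sqSubOnePow (z a : ℂ) : ℂ := (z - 1) ^ a * (z + 1) ^ a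

/-- `((z - 1) / (z + 1)) ^ a`, with the phases `-π < arg (z ± 1) < π`. -/
def quotientPow (z a : ℂ) : ℂ := (z - 1) ^ a / (z + 1) ^ a

/-- Some contour `𝒞⁽⁺⁾` for `z` (all of them give the same integrals). -/
def someContour (z : ℂ) : (p : ℂ) × Path p p :=
  @Classical.epsilon _ ⟨⟨0, Path.refl 0⟩⟩ (fun C : (p : ℂ) × Path p p => IsContour z C.2)

/-- Schläfli's integral
`Γ(ν+μ+1) / Γ(ν+1) * 1 / (2 ^ (ν+1) π i) * (z²-1) ^ (μ/2) * ∮ (t²-1) ^ ν / (t-z) ^ (ν+μ+1) dt`. -/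
def schlafliFormula (ν : ℂ) (μ : ℤ) (z : ℂ) : ℂ :=
  Complex.Gamma (ν + μ + 1) / Complex.Gamma (ν + 1) *
    (1 / ((2 : ℂ) ^ (ν + 1) * Real.pi * Complex.I)) * sqSubOnePow z ((μ : ℂ) / 2) *
    contourIntegral (someContour z).2 (schlafliKernel ν μ z)

open Classical in
/-- The associated Legendre function of the first kind `P_ν^μ(z)` of complex degree `ν` and integer
order `μ`: Schläfli's integral where the two gamma functions in it are finite, and its limit
with respect to the degree (all the singularities are removable) elsewhere. -/
def legendreP (ν : ℂ) (μ : ℤ) (z : ℂ) : ℂ :=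
  if IsGammaPole (ν + 1) ∨ IsGammaPole (ν + μ + 1) then
    limUnder (𝓝[≠] ν) (fun w => schlafliFormula w μ z)
  else schlafliFormula ν μ z

/-! ### The two right-hand sides -/

/-- The representation of `∂P_ν^μ(z)/∂ν` by integrals over a contour `𝒞⁽⁺⁾`. -/
def firstRHS {p : ℂ} (C : Path p p) (ν : ℂ) (μ : ℤ) (z : ℂ) : ℂ :=
  -legendreP ν μ z * Complex.log ((z + 1) / 2)
    + (Complex.digamma (ν + μ + 1) - Complex.digamma (ν + 1)) * legendreP ν μ z
    + Complex.Gamma (ν + μ + 1) / Complex.Gamma (ν + 1) *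
        (1 / ((2 : ℂ) ^ (ν + 1) * Real.pi * Complex.I)) * sqSubOnePow z ((μ : ℂ) / 2) *
        contourIntegral C (fun t => schlafliKernel ν μ z t * Complex.log ((t + 1) / 2))
    + Complex.Gamma (ν + μ + 1) / Complex.Gamma (ν + 1) *
        (1 / ((2 : ℂ) ^ (ν + 1) * Real.pi * Complex.I)) * sqSubOnePow z (-(μ : ℂ) / 2) *
        contourIntegral C (fun t => schlafliKernel ν (-μ) z t * Complex.log ((t + 1) / 2))

/-- The representation of `∂P_ν^μ(z)/∂ν` by integrals over a contour `𝒞'⁽⁺⁾`; here `ln ((u + 1) / 2)`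
is the branch `rayLog z u - ln 2`. -/
def secondRHS {p : ℂ} (C : Path p p) (ν : ℂ) (μ : ℤ) (z : ℂ) : ℂ :=
  -legendreP ν μ z * Complex.log ((z + 1) / 2)
    + (Complex.digamma (ν + 1) - Complex.digamma (ν - μ + 1)) * legendreP ν μ z
    + Complex.Gamma (ν + 1) / Complex.Gamma (ν - μ + 1) *
        (1 / ((2 : ℂ) ^ (ν + 1) * Real.pi * Complex.I)) * quotientPow z ((μ : ℂ) / 2) *
        contourIntegral C (fun u => schendelKernel ν μ z u * (rayLog z u - Complex.log 2))
    + Complex.Gamma (ν + 1) / Complex.Gamma (ν - μ + 1) *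
        (1 / ((2 : ℂ) ^ (ν + 1) * Real.pi * Complex.I)) * quotientPow z (-(μ : ℂ) / 2) *
        contourIntegral C (fun u => schendelKernel ν (-μ) z u * (rayLog z u - Complex.log 2))

end Legendre

end

namespace Legendre

/-! ### Primitives of holomorphic functions -/

/-! Both integrands are `exp (ν L)` times a factor free of `ν`, where `L` is a branch of `ln ((t² -
1) / (t - z))`. Differentiating in `ν` therefore brings down `L`, while the prefactor contributes
the digamma difference and `-ln 2`. In the `t`-plane `L = ln (t + 1) + arcLog z t`. The involution
`swap z`, `t ↦ (z t - 1) / (t - z)`, preserves `L` and exchanges its two summands up to the constant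
`ln (z + 1)`; on the kernels it turns `μ` into `-μ` at the cost of `(z² - 1) ^ μ`. So the integral
with `arcLog` becomes the integral of order `-μ` with `ln (t + 1)`, which is the last term of the
first formula (`circleIntegral_schlafliKernel_neg_log`, `schlafli_log_sum`, `hasDerivAt_firstRHS`).
The same involution acts on the `u`-plane and gives the second formula, with `((z - 1) / (z + 1)) ^
μ` as the factor.

No homotopy is needed to move contours. A holomorphic function on either doubly cut plane has a
primitive after subtraction of one simple pole term (`exists_primitive_schendelDomain`,
`exists_primitive_schlafliDomain`), so its integral depends on a winding number only. All integrals
are thus taken over one circle that lies in both cut planes and on which the two branches of `L`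
agree (`exists_isCommonCircle`).

The second formula also needs the `u`-integral to represent the same function. On the common circle
this is `schendel_eq_schlafli`: both families of integrals satisfy three-term recurrences in the
order, coming from exact derivatives, and they match at orders 0 and 1.

Finally the gamma quotients are finite products or their reciprocals. For order `-m` the two
representations have denominators with disjoint zero sets, hence together define an entire function
of `ν` (`exists_entire`). The Legendre function equals it everywhere, so the formulas at regular
degrees pass to the exceptional ones by continuity of the derivative. -/

lemma hasDerivAt_glue {A B : Set ℂ} (hA : IsOpen A) (hB : IsOpen B) {f F G : ℂ → ℂ} {k : ℂ}
    (hF : ∀ x ∈ A, HasDerivAt F (f x) x) (hG : ∀ x ∈ B, HasDerivAt G (f x) x)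
    (h : ∀ x ∈ A ∩ B, F x - G x = k) :
    ∃ H : ℂ → ℂ, ∀ x ∈ A ∪ B, HasDerivAt H (f x) x := by
  classical
  refine ⟨fun x => if x ∈ A then F x else G x + k, ?_⟩
  rintro x (hx | hx)
  · refine (hF x hx).congr_of_eventuallyEq ?_
    filter_upwards [hA.mem_nhds hx] with y hy
    rw [if_pos hy]
  · refine ((hG x hx).add_const k).congr_of_eventuallyEq ?_
    filter_upwards [hB.mem_nhds hx] with y hy
    split_ifs with hyA
    · linear_combination h y ⟨hyA, hy⟩
    · rfl

lemma exists_sub_eq_const {S : Set ℂ} (hS : IsOpen S) (hc : Convex ℝ S) {f F G : ℂ → ℂ}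
    (hF : ∀ x ∈ S, HasDerivAt F (f x) x) (hG : ∀ x ∈ S, HasDerivAt G (f x) x) :
    ∃ k, ∀ x ∈ S, F x - G x = k := by
  refine hS.exists_is_const_of_deriv_eq_zero (f := fun x => F x - G x) hc.isPreconnected ?_ ?_
  · intro x hx
    exact ((hF x hx).sub (hG x hx)).differentiableAt.differentiableWithinAt
  · intro x hx
    exact ((hF x hx).sub (hG x hx)).deriv.trans (sub_self _)

lemma exists_primitive_of_convex {S : Set ℂ} (hS : IsOpen S) (hc : Convex ℝ S) {f : ℂ → ℂ}
    (hf : DifferentiableOn ℂ f S) : ∃ F : ℂ → ℂ, ∀ x ∈ S, HasDerivAt F (f x) x := by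
  obtain ⟨F, hF⟩ := hc.exists_forall_hasDerivWithinAt hf
  exact ⟨F, fun x hx => (hF x hx).hasDerivAt (hS.mem_nhds hx)⟩

/-- The strip `|Im v| < π` with the horizontal half-line from `κ` to the right removed. -/
def slitStrip (κ : ℂ) : Set ℂ :=
  {v | -Real.pi < v.im ∧ v.im < Real.pi ∧ (v.im ≠ κ.im ∨ v.re < κ.re)}

/-- The slit strip is a chain of three convex sets: above the slit, left of its tip, below it.
Consecutive ones meet in convex sets, on which primitives differ by a constant. -/
lemma exists_primitive_slitStrip (κ : ℂ) {f : ℂ → ℂ} (hf : DifferentiableOn ℂ f (slitStrip κ)) :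
    ∃ F : ℂ → ℂ, ∀ x ∈ slitStrip κ, HasDerivAt F (f x) x := by
  set S : Set ℂ := {v | -Real.pi < v.im} ∩ {v | v.im < Real.pi} with hS
  have hSo : IsOpen S := (isOpen_lt continuous_const Complex.continuous_im).inter
    (isOpen_lt Complex.continuous_im continuous_const)
  have hSc : Convex ℝ S := (convex_halfSpace_im_gt _).inter (convex_halfSpace_im_lt _)
  set A : Set ℂ := S ∩ {v | κ.im < v.im} with hA
  set B : Set ℂ := S ∩ {v | v.im < κ.im} with hB
  set M : Set ℂ := S ∩ {v | v.re < κ.re} with hM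
  have hAo : IsOpen A := hSo.inter (isOpen_lt continuous_const Complex.continuous_im)
  have hBo : IsOpen B := hSo.inter (isOpen_lt Complex.continuous_im continuous_const)
  have hMo : IsOpen M := hSo.inter (isOpen_lt Complex.continuous_re continuous_const)
  have hAc : Convex ℝ A := hSc.inter (convex_halfSpace_im_gt _)
  have hBc : Convex ℝ B := hSc.inter (convex_halfSpace_im_lt _)
  have hMc : Convex ℝ M := hSc.inter (convex_halfSpace_re_lt _)
  have hAs : A ⊆ slitStrip κ := fun v hv => ⟨hv.1.1, hv.1.2, Or.inl (ne_of_gt hv.2)⟩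
  have hBs : B ⊆ slitStrip κ := fun v hv => ⟨hv.1.1, hv.1.2, Or.inl (ne_of_lt hv.2)⟩
  have hMs : M ⊆ slitStrip κ := fun v hv => ⟨hv.1.1, hv.1.2, Or.inr hv.2⟩
  obtain ⟨FA, hFA⟩ := exists_primitive_of_convex hAo hAc (hf.mono hAs)
  obtain ⟨FB, hFB⟩ := exists_primitive_of_convex hBo hBc (hf.mono hBs)
  obtain ⟨FM, hFM⟩ := exists_primitive_of_convex hMo hMc (hf.mono hMs)
  obtain ⟨k, hk⟩ := exists_sub_eq_const (hAo.inter hMo) (hAc.inter hMc)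
    (fun x hx => hFA x hx.1) (fun x hx => hFM x hx.2)
  obtain ⟨G, hG⟩ := hasDerivAt_glue hAo hMo hFA hFM hk
  obtain ⟨l, hl⟩ := exists_sub_eq_const (hMo.inter hBo) (hMc.inter hBc)
    (fun x hx => hG x (Or.inr hx.1)) (fun x hx => hFB x hx.2)
  -- The upper and lower pieces are disjoint, so only the overlap with the left piece imposes a
  -- condition.
  obtain ⟨H, hH⟩ := hasDerivAt_glue (k := l) (hAo.union hMo) hBo hG hFB (by
    rintro x ⟨hx | hx, hxB⟩
    · exact absurd (lt_trans (show κ.im < x.im from hx.2) hxB.2) (lt_irrefl _)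
    · exact hl x ⟨hx, hxB⟩)
  refine ⟨H, fun x hx => hH x ?_⟩
  obtain ⟨h1, h2, h3⟩ := hx
  rcases h3 with h3 | h3
  · rcases lt_or_gt_of_ne h3 with h3 | h3
    · exact Or.inr ⟨⟨h1, h2⟩, h3⟩
    · exact Or.inl (Or.inl ⟨⟨h1, h2⟩, h3⟩)
  · exact Or.inl (Or.inr ⟨⟨h1, h2⟩, h3⟩)

/-! ### Primitives up to a residue term on a doubly slit plane -/

lemma one_sub_div_mem_slitPlane_of {a l : ℂ} (ha : a ≠ 0)
    (h : ∀ x : ℝ, 1 ≤ x → l ≠ a * x) : 1 - l / a ∈ Complex.slitPlane := by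
  by_contra hn
  rw [Complex.mem_slitPlane_iff_not_le_zero, not_not, Complex.le_def] at hn
  simp only [Complex.zero_re, Complex.zero_im] at hn
  refine h (1 - (1 - l / a).re) (by linarith [hn.1]) ?_
  have : (1 - l / a) = (((1 - l / a).re : ℝ) : ℂ) := Complex.ext (by simp) (by simpa using hn.2)
  rw [Complex.ofReal_sub, ← this]
  field_simp
  simp

lemma ne_of_one_sub_div_mem_slitPlane {a l : ℂ} (ha : a ≠ 0)
    (h : 1 - l / a ∈ Complex.slitPlane) (x : ℝ) (hx : 1 ≤ x) : l ≠ a * x := by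
  rintro rfl
  rw [mul_div_cancel_left₀ _ ha] at h
  have h' : ((1 - x : ℝ) : ℂ) ∈ Complex.slitPlane := by simpa using h
  rw [Complex.ofReal_mem_slitPlane] at h'
  linarith

/-- The plane with the segment `[0, 1]` and the half-line `a * [1, ∞)` removed. -/
def segmentSlitPlane (a : ℂ) : Set ℂ :=
  {l | l ≠ 0 ∧ 1 - l / a ∈ Complex.slitPlane ∧ 1 - 1 / l ∈ Complex.slitPlane}

lemma isOpen_segmentSlitPlane_aux (a : ℂ) :
    IsOpen {l : ℂ | -l ∈ Complex.slitPlane ∧ 1 - l / a ∈ Complex.slitPlane} :=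
  (Complex.isOpen_slitPlane.preimage continuous_neg).inter
    (Complex.isOpen_slitPlane.preimage (by fun_prop : Continuous fun l : ℂ => 1 - l / a))

lemma one_sub_one_div_mem_slitPlane_of_neg {l : ℂ} (hl : -l ∈ Complex.slitPlane) :
    1 - 1 / l ∈ Complex.slitPlane := by
  have hl0 : l ≠ 0 := fun h => Complex.slitPlane_ne_zero hl (by simp [h])
  by_contra hn
  rw [Complex.mem_slitPlane_iff_not_le_zero, not_not, Complex.le_def] at hn
  simp only [Complex.zero_re, Complex.zero_im] at hn
  set y := (1 - 1 / l).re with hy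
  have : (1 - 1 / l) = ((y : ℝ) : ℂ) := Complex.ext (by simp [hy]) (by simpa using hn.2)
  have h2 : 1 / l = ((1 - y : ℝ) : ℂ) := by push_cast; rw [← this]; ring
  have h3 : -l = ((-(1 - y)⁻¹ : ℝ) : ℂ) := by
    push_cast at h2 ⊢; rw [← h2]; simp
  rw [h3, Complex.ofReal_mem_slitPlane] at hl
  have : 0 < (1 - y)⁻¹ := by
    have := hn.1
    exact inv_pos.mpr (by linarith)
  linarith

/-- If `-exp v = a x` with `x ≥ 1`, then `v = log x + log (-a)` with `log x ≥ 0`, a point of the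
removed half-line of the strip. -/
lemma neg_exp_mem {a v : ℂ} (ha : a ≠ 0) (hv : v ∈ slitStrip (Complex.log (-a))) :
    -(-Complex.exp v) ∈ Complex.slitPlane ∧ 1 - (-Complex.exp v) / a ∈ Complex.slitPlane := by
  obtain ⟨h1, h2, h3⟩ := hv
  have hlog : Complex.log (Complex.exp v) = v := Complex.log_exp h1 h2.le
  constructor
  · rw [neg_neg, Complex.mem_slitPlane_iff_arg]
    refine ⟨?_, Complex.exp_ne_zero _⟩
    rw [← Complex.log_im, hlog]
    exact h2.ne
  · refine one_sub_div_mem_slitPlane_of ha fun x hx h => ?_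
    have hx0 : 0 < x := by linarith
    have h' : Complex.exp v = (x : ℂ) * (-a) := by linear_combination -h
    have h4 : v = Real.log x + Complex.log (-a) := by
      rw [← hlog, h', Complex.log_ofReal_mul hx0 (neg_ne_zero.mpr ha)]
    have h5 : v.im = (Complex.log (-a)).im := by rw [h4]; simp
    have h6 : v.re = Real.log x + (Complex.log (-a)).re := by rw [h4]; simp
    have h7 : 0 ≤ Real.log x := Real.log_nonneg hx
    rcases h3 with h3 | h3
    · exact h3 h5
    · linarith

lemma log_neg_mem_slitStrip {a l : ℂ} (ha : a ≠ 0) (h1 : -l ∈ Complex.slitPlane)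
    (h2 : 1 - l / a ∈ Complex.slitPlane) : Complex.log (-l) ∈ slitStrip (Complex.log (-a)) := by
  refine ⟨?_, ?_, ?_⟩
  · rw [Complex.log_im]; exact Complex.neg_pi_lt_arg _
  · rw [Complex.log_im]
    exact lt_of_le_of_ne (Complex.arg_le_pi _) (Complex.mem_slitPlane_iff_arg.mp h1).1
  · by_contra! hn
    obtain ⟨h3, h4⟩ := hn
    set r := (Complex.log (-l)).re - (Complex.log (-a)).re with hr
    refine ne_of_one_sub_div_mem_slitPlane ha h2 (Real.exp r)
      (Real.one_le_exp (by linarith)) ?_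
    have h5 : Complex.log (-l) = Complex.log (-a) + r := by
      apply Complex.ext <;> simp [hr, h3]
    have h6 := congrArg Complex.exp h5
    rw [Complex.exp_add, Complex.exp_log (Complex.slitPlane_ne_zero h1),
      Complex.exp_log (neg_ne_zero.mpr ha)] at h6
    push_cast
    linear_combination -h6

/-- The substitution `l = -exp v` carries the slit strip onto the plane without `[0, ∞)` and `a *
[1, ∞)`, so a primitive can be pulled back from there. -/
lemma exists_primitive_of_neg_mem_slitPlane {a : ℂ} (ha : a ≠ 0) {f : ℂ → ℂ}
    (hf : DifferentiableOn ℂ f {l | -l ∈ Complex.slitPlane ∧ 1 - l / a ∈ Complex.slitPlane}) :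
    ∃ F : ℂ → ℂ, ∀ l ∈ {l | -l ∈ Complex.slitPlane ∧ 1 - l / a ∈ Complex.slitPlane},
      HasDerivAt F (f l) l := by
  obtain ⟨G, hG⟩ := exists_primitive_slitStrip (Complex.log (-a))
    (f := fun v => f (-Complex.exp v) * -Complex.exp v) (by
      refine DifferentiableOn.mul ?_ (by fun_prop)
      exact hf.comp (by fun_prop) fun v hv => neg_exp_mem ha hv)
  refine ⟨fun l => G (Complex.log (-l)), fun l hl => ?_⟩
  have hl0 : -l ≠ 0 := Complex.slitPlane_ne_zero hl.1
  have h := (hG _ (log_neg_mem_slitStrip ha hl.1 hl.2)).comp l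
    ((hasDerivAt_neg l).clog hl.1)
  refine h.congr_deriv ?_
  rw [Complex.exp_log hl0, neg_neg]
  have : l ≠ 0 := fun h => hl0 (by simp [h])
  field_simp

/-- A half-plane on which a gap of the slit plane `segmentSlitPlane a` can be crossed. -/
lemma exists_halfPlane {a : ℂ} (ha : a - 1 ∈ Complex.slitPlane) :
    ∃ P Q d : ℝ, (∀ l : ℂ, 1 < l.re → P * l.re + Q * l.im < d → 1 - l / a ∈ Complex.slitPlane) ∧
      ∀ l : ℂ, 1 - l / a ∈ Complex.slitPlane → l.im = 0 → 1 < l.re →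
        P * l.re + Q * l.im < d := by
  have ha0 : a ≠ 0 := by
    rintro rfl
    rw [Complex.mem_slitPlane_iff] at ha
    norm_num at ha
  by_cases him : a.im = 0
  · have har : 1 < a.re := by
      rw [Complex.mem_slitPlane_iff] at ha
      simpa [him] using ha
    refine ⟨1, 0, a.re, fun l h1 h2 => one_sub_div_mem_slitPlane_of ha0 fun x hx h => ?_,
      fun l h1 h2 h3 => ?_⟩
    · have : l.re = a.re * x := by rw [h]; simp
      nlinarith
    · by_contra! hn
      have hn : a.re ≤ l.re := by linarith
      refine ne_of_one_sub_div_mem_slitPlane ha0 h1 (l.re / a.re)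
        ((one_le_div (by linarith)).mpr hn) ?_
      have : a.re ≠ 0 := by linarith
      apply Complex.ext <;> simp [him, h2]
      field_simp
  -- For `Re a > 0` the boundary is the line through `0` and `a`, and the half-plane is the side
  -- containing the positive reals. For `Re a ≤ 0` the ray never enters `Re l > 1`; the absolute
  -- value covers both cases.
  · refine ⟨-1, |a.re| / a.im, 0,
      fun l h1 h2 => one_sub_div_mem_slitPlane_of ha0 fun x hx h => ?_, fun l h1 h2 h3 => ?_⟩
    · have h3 : l.re = a.re * x := by rw [h]; simp
      have h4 : l.im = a.im * x := by rw [h]; simp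
      have h5 : 0 < a.re := by
        by_contra! h0
        nlinarith
      rw [abs_of_pos h5, h3, h4] at h2
      have : a.re / a.im * (a.im * x) = a.re * x := by field_simp
      linarith
    · rw [h2]; linarith

/-- The region is the simply connected `V`, slit along all of `[0, ∞)`, together with a convex set
`N` that reopens the gap beyond `1`. Primitives on `V` and `N` differ by one constant above the real
axis and another below; subtracting a multiple of a logarithm makes the two constants equal. -/
theorem exists_primitive_segmentSlitPlane {a : ℂ} (ha : a - 1 ∈ Complex.slitPlane) {f : ℂ → ℂ}
    (hf : DifferentiableOn ℂ f (segmentSlitPlane a)) :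
    ∃ (c : ℂ) (F : ℂ → ℂ), ∀ l ∈ segmentSlitPlane a, HasDerivAt F (f l - c / l) l := by
  have ha0 : a ≠ 0 := by
    rintro rfl
    rw [Complex.mem_slitPlane_iff] at ha
    norm_num at ha
  obtain ⟨P, Q, d, hN1, hN2⟩ := exists_halfPlane ha
  set V : Set ℂ := {l | -l ∈ Complex.slitPlane ∧ 1 - l / a ∈ Complex.slitPlane} with hV
  set N : Set ℂ := {l | 1 < l.re} ∩ {l | P * l.re + Q * l.im < d} with hN
  have hVo : IsOpen V := isOpen_segmentSlitPlane_aux a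
  have hNo : IsOpen N := (isOpen_lt continuous_const Complex.continuous_re).inter
    (isOpen_lt (by fun_prop) continuous_const)
  have hNc : Convex ℝ N := by
    refine (convex_halfSpace_re_gt 1).inter ?_
    refine convex_halfSpace_lt (f := fun l : ℂ => P * l.re + Q * l.im) ⟨?_, ?_⟩ d
    · intro x y; simp; ring
    · intro t x; simp; ring
  have hVs : V ⊆ segmentSlitPlane a := fun l hl =>
    ⟨fun h => Complex.slitPlane_ne_zero hl.1 (by simp [h]), hl.2,
      one_sub_one_div_mem_slitPlane_of_neg hl.1⟩
  have hNre : ∀ l ∈ N, l ∈ Complex.slitPlane := fun l hl => by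
    rw [Complex.mem_slitPlane_iff]
    have : 1 < l.re := hl.1
    exact Or.inl (by linarith)
  have hNs : N ⊆ segmentSlitPlane a := by
    intro l hl
    have h0 : l ≠ 0 := Complex.slitPlane_ne_zero (hNre l hl)
    refine ⟨h0, hN1 l hl.1 hl.2, one_sub_div_mem_slitPlane_of h0 fun x hx h => ?_⟩
    have h1 : (l * x).re = 1 := by rw [← h]; simp
    have h2 : 1 < l.re := hl.1
    simp at h1
    nlinarith
  have hcover : segmentSlitPlane a ⊆ V ∪ N := by
    rintro l ⟨h0, h1, h2⟩
    by_cases hl : -l ∈ Complex.slitPlane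
    · exact Or.inl ⟨hl, h1⟩
    · rw [Complex.mem_slitPlane_iff] at hl
      push Not at hl
      simp only [Complex.neg_re, Complex.neg_im, neg_eq_zero] at hl
      have hre : 0 < l.re := by
        refine lt_of_le_of_ne (by linarith [hl.1]) fun h => h0 (Complex.ext h.symm hl.2)
      have hlr : l = (l.re : ℂ) := Complex.ext (by simp) (by simp [hl.2])
      have h3 : 1 < l.re := by
        have h4 : ((1 - 1 / l.re : ℝ) : ℂ) ∈ Complex.slitPlane := by
          push_cast; rwa [← hlr]
        rw [Complex.ofReal_mem_slitPlane, sub_pos, div_lt_one hre] at h4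
        exact h4
      exact Or.inr ⟨h3, hN2 l h1 hl.2 h3⟩
  obtain ⟨F, hF⟩ := exists_primitive_of_neg_mem_slitPlane ha0 (hf.mono hVs)
  obtain ⟨G, hG⟩ := exists_primitive_of_convex hNo hNc (hf.mono hNs)
  have hup : IsOpen (N ∩ {l : ℂ | 0 < l.im}) :=
    hNo.inter (isOpen_lt continuous_const Complex.continuous_im)
  have hdown : IsOpen (N ∩ {l : ℂ | l.im < 0}) :=
    hNo.inter (isOpen_lt Complex.continuous_im continuous_const)
  have hNV : ∀ l ∈ N, l.im ≠ 0 → l ∈ V := fun l hl him => by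
    refine ⟨?_, hN1 l hl.1 hl.2⟩
    rw [Complex.mem_slitPlane_iff]
    exact Or.inr (by simpa using him)
  obtain ⟨k, hk⟩ := exists_sub_eq_const hup (hNc.inter (convex_halfSpace_im_gt 0))
    (fun x hx => hF x (hNV x hx.1 (ne_of_gt hx.2))) (fun x hx => hG x hx.1)
  obtain ⟨k', hk'⟩ := exists_sub_eq_const hdown (hNc.inter (convex_halfSpace_im_lt 0))
    (fun x hx => hF x (hNV x hx.1 (ne_of_lt hx.2))) (fun x hx => hG x hx.1)
  -- Passing from `log l` to `log (-l)` subtracts `πi` above the axis and adds it below, so the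
  -- corrected constants are `k + c πi` and `k' - c πi`; this `c` equates them.
  set c : ℂ := (k' - k) / (2 * Real.pi * Complex.I) with hc
  have hpi : (2 * Real.pi * Complex.I : ℂ) ≠ 0 := Complex.two_pi_I_ne_zero
  have hck : c * (2 * Real.pi * Complex.I) = k' - k := div_mul_cancel₀ _ hpi
  refine ⟨c, ?_⟩
  have hF2 : ∀ x ∈ V, HasDerivAt (fun l => F l - c * Complex.log (-l)) (f x - c / x) x := by
    intro x hx
    have hx0 : x ≠ 0 := (hVs hx).1
    refine ((hF x hx).sub (((hasDerivAt_neg x).clog hx.1).const_mul c)).congr_deriv ?_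
    field_simp
  have hG2 : ∀ x ∈ N, HasDerivAt (fun l => G l - c * Complex.log l) (f x - c / x) x := by
    intro x hx
    refine ((hG x hx).sub ((Complex.hasDerivAt_log (hNre x hx)).const_mul c)).congr_deriv ?_
    rw [div_eq_mul_inv]
  obtain ⟨H, hH⟩ := hasDerivAt_glue (k := k + c * (Real.pi * Complex.I)) hVo hNo hF2 hG2 (by
    rintro x ⟨hxV, hxN⟩
    rcases lt_trichotomy x.im 0 with him | him | him
    · have h1 := hk' x ⟨hxN, him⟩
      have h2 : Complex.log (-x) = Complex.log x + Real.pi * Complex.I := by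
        simp only [Complex.log, norm_neg, Complex.arg_neg_eq_arg_add_pi_of_im_neg him]
        push_cast; ring
      simp only [h2]
      linear_combination h1 - hck
    · exfalso
      have h1 := hxV.1
      rw [Complex.mem_slitPlane_iff] at h1
      have h2 : 1 < x.re := hxN.1
      rcases h1 with h1 | h1
      · simp at h1; linarith
      · exact h1 (by simpa using him)
    · have h1 := hk x ⟨hxN, him⟩
      have h2 : Complex.log (-x) = Complex.log x - Real.pi * Complex.I := by
        simp only [Complex.log, norm_neg, Complex.arg_neg_eq_arg_sub_pi_of_im_pos him]
        push_cast; ring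
      simp only [h2]
      linear_combination h1)
  exact ⟨H, fun l hl => hH l (hcover hl)⟩

/-! ### The cut planes -/

/-- The `t`-plane with the two cuts `halfLineCut` and `arcCut z`. -/
def schlafliDomain (z : ℂ) : Set ℂ :=
  {t | t + 1 ∈ Complex.slitPlane ∧ t ≠ z ∧ (z + 1) * (t - 1) / (t - z) ∈ Complex.slitPlane}

/-- The `u`-plane with the two cuts `rayCut z` and `segmentCut z`. -/
def schendelDomain (z : ℂ) : Set ℂ :=
  {u | (u + 1) / (z + 1) ∈ Complex.slitPlane ∧ u ≠ z ∧ (u - 1) / (u - z) ∈ Complex.slitPlane}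

lemma exists_eq_neg_of_notMem_slitPlane {w : ℂ} (hw : w ∉ Complex.slitPlane) :
    ∃ x : ℝ, 0 ≤ x ∧ w = -(x : ℂ) := by
  rw [Complex.mem_slitPlane_iff_not_le_zero, not_not, Complex.le_def] at hw
  simp only [Complex.zero_re, Complex.zero_im] at hw
  exact ⟨-w.re, by linarith [hw.1], Complex.ext (by simp) (by simp [hw.2])⟩

lemma two_div_mem_slitPlane {w : ℂ} (hw : w ∈ Complex.slitPlane) :
    2 / w ∈ Complex.slitPlane := by
  have h0 := Complex.normSq_pos.mpr (Complex.slitPlane_ne_zero hw)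
  have h : 0 < w⁻¹.re ∨ w⁻¹.im ≠ 0 := by
    rw [Complex.inv_re, Complex.inv_im]
    rcases Complex.mem_slitPlane_iff.mp hw with h | h
    · exact Or.inl (div_pos h h0)
    · exact Or.inr (div_ne_zero (neg_ne_zero.mpr h) h0.ne')
  rw [Complex.mem_slitPlane_iff]
  have h2 : 2 / w = ((2 : ℝ) : ℂ) * w⁻¹ := by push_cast; rw [div_eq_mul_inv]
  rw [h2, Complex.re_ofReal_mul, Complex.im_ofReal_mul]
  rcases h with h | h
  · exact Or.inl (by positivity)
  · exact Or.inr (mul_ne_zero two_ne_zero h)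

variable {z : ℂ}

lemma add_one_mem_slitPlane (hz : z - 1 ∈ Complex.slitPlane) : z + 1 ∈ Complex.slitPlane := by
  rw [Complex.mem_slitPlane_iff] at hz ⊢
  simp only [Complex.sub_re, Complex.one_re, Complex.sub_im, Complex.one_im, Complex.add_re,
    Complex.add_im, sub_zero, add_zero] at hz ⊢
  rcases hz with h | h
  · exact Or.inl (by linarith)
  · exact Or.inr h

lemma sub_one_ne_zero (hz : z - 1 ∈ Complex.slitPlane) : z - 1 ≠ 0 :=
  Complex.slitPlane_ne_zero hz

lemma add_one_ne_zero (hz : z - 1 ∈ Complex.slitPlane) : z + 1 ≠ 0 :=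
  Complex.slitPlane_ne_zero (add_one_mem_slitPlane hz)

lemma add_ofReal_ne_zero (hz : z - 1 ∈ Complex.slitPlane) {η : ℝ} (hη : 0 ≤ η) :
    z + 1 + η ≠ 0 := by
  intro h
  have h1 : z - 1 = ((-2 - η : ℝ) : ℂ) := by push_cast; linear_combination h
  rw [h1, Complex.ofReal_mem_slitPlane] at hz
  linarith

lemma mem_schlafliDomain (hz : z - 1 ∈ Complex.slitPlane) {t : ℂ}
    (ht : t ∉ halfLineCut ∪ arcCut z) : t ∈ schlafliDomain z := by
  by_contra hn
  apply ht
  by_cases h1 : t + 1 ∈ Complex.slitPlane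
  swap
  · obtain ⟨x, hx, h⟩ := exists_eq_neg_of_notMem_slitPlane h1
    exact Or.inl ⟨1 + x, by linarith, by push_cast; linear_combination h⟩
  by_cases h2 : t = z
  · exact Or.inr (Or.inr h2)
  by_cases h3 : (z + 1) * (t - 1) / (t - z) ∈ Complex.slitPlane
  · exact absurd ⟨h1, h2, h3⟩ hn
  obtain ⟨x, hx, h⟩ := exists_eq_neg_of_notMem_slitPlane h3
  have h4 := add_ofReal_ne_zero hz hx
  rw [div_eq_iff (sub_ne_zero.mpr h2)] at h
  -- Solving `(z + 1) (t - 1) / (t - z) = -x` for `t` gives the arc with parameter `η = 1 + x`.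
  refine Or.inr (Or.inl ⟨1 + x, by linarith, ?_⟩)
  push_cast
  rw [← add_assoc, eq_div_iff h4]
  linear_combination h

lemma mem_schendelDomain (hz : z - 1 ∈ Complex.slitPlane) {u : ℂ}
    (hu : u ∉ rayCut z ∪ segmentCut z) : u ∈ schendelDomain z := by
  have hz1 := add_one_ne_zero hz
  by_contra hn
  apply hu
  by_cases h1 : (u + 1) / (z + 1) ∈ Complex.slitPlane
  swap
  · obtain ⟨x, hx, h⟩ := exists_eq_neg_of_notMem_slitPlane h1
    rw [div_eq_iff hz1] at h
    rcases hx.eq_or_lt with rfl | hx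
    · refine Or.inl (Or.inr ?_)
      rw [mem_singleton_iff]
      push_cast at h
      linear_combination h
    -- Here `u = -1 - x (z + 1)`, so `2 / (1 - η) = -x`. The value `x = 0` was the separately
    -- included end point; the segment below is treated likewise.
    · refine Or.inl (Or.inl ⟨1 + 2 / x, by rw [lt_add_iff_pos_right]; positivity, ?_⟩)
      have hx' : (x : ℂ) ≠ 0 := by exact_mod_cast hx.ne'
      have : (1 : ℂ) - ((1 + 2 / x : ℝ) : ℂ) = -2 / x := by push_cast; ring
      rw [this]
      field_simp
      linear_combination h
  by_cases h2 : u = z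
  · exact Or.inr (Or.inl ⟨1, le_rfl, by rw [h2]; push_cast; ring⟩)
  by_cases h3 : (u - 1) / (u - z) ∈ Complex.slitPlane
  · exact absurd ⟨h1, h2, h3⟩ hn
  obtain ⟨x, hx, h⟩ := exists_eq_neg_of_notMem_slitPlane h3
  rw [div_eq_iff (sub_ne_zero.mpr h2)] at h
  rcases hx.eq_or_lt with rfl | hx
  · refine Or.inr (Or.inr ?_)
    rw [mem_singleton_iff]
    push_cast at h
    linear_combination h
  · refine Or.inr (Or.inl ⟨1 + 2 / x, by rw [le_add_iff_nonneg_right]; positivity, ?_⟩)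
    have hx' : (x : ℂ) ≠ 0 := by exact_mod_cast hx.ne'
    have hx1 : (x : ℂ) + 1 ≠ 0 := by
      have : x + 1 ≠ 0 := by positivity
      exact_mod_cast this
    have : (1 : ℂ) + ((1 + 2 / x : ℝ) : ℂ) = 2 * (x + 1) / x := by push_cast; field_simp; ring
    rw [this]
    field_simp
    linear_combination h

lemma schlafliDomain_ne_one {t : ℂ} (ht : t ∈ schlafliDomain z) : t - 1 ≠ 0 := fun h =>
  Complex.slitPlane_ne_zero ht.2.2 (by simp [h])

lemma schendelDomain_ne_one {u : ℂ} (hu : u ∈ schendelDomain z) : u - 1 ≠ 0 := fun h =>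
  Complex.slitPlane_ne_zero hu.2.2 (by simp [h])

lemma schendelDomain_add_one_ne_zero {u : ℂ} (hu : u ∈ schendelDomain z) : u + 1 ≠ 0 := fun h =>
  Complex.slitPlane_ne_zero hu.1 (by simp [h])

lemma schlafliDomain_add_one_ne_zero {t : ℂ} (ht : t ∈ schlafliDomain z) : t + 1 ≠ 0 :=
  Complex.slitPlane_ne_zero ht.1

/-- The affine coordinate `l = (z - u) / (z - 1)` sends `z`, `1`, `-1` to `0`, `1`, `a = (z + 1) /
(z - 1)`, and hence the two cuts to `[0, 1]` and `a * [1, ∞)`. The hypothesis on `z` is what keeps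
`a` off `(-∞, 1]`, since `a - 1 = 2 / (z - 1)`. -/
theorem exists_primitive_schendelDomain (hz : z - 1 ∈ Complex.slitPlane) {f : ℂ → ℂ}
    (hf : DifferentiableOn ℂ f (schendelDomain z)) :
    ∃ (c : ℂ) (F : ℂ → ℂ), ∀ u ∈ schendelDomain z, HasDerivAt F (f u - c / (u - z)) u := by
  have hz1 := add_one_ne_zero hz
  have hz2 := sub_one_ne_zero hz
  have ha : (z + 1) / (z - 1) - 1 ∈ Complex.slitPlane := by
    have : (z + 1) / (z - 1) - 1 = 2 / (z - 1) := by field_simp; ring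
    rw [this]
    exact two_div_mem_slitPlane hz
  obtain ⟨c, F, hF⟩ := exists_primitive_segmentSlitPlane ha
    (f := fun l => f (z - (z - 1) * l) * -(z - 1)) (by
      refine DifferentiableOn.mul_const ?_ _
      refine hf.comp (by fun_prop) ?_
      rintro l ⟨h0, h1, h2⟩
      refine ⟨?_, ?_, ?_⟩
      · convert h1 using 1
        field_simp
        ring
      · intro h
        have : (z - 1) * l = 0 := by linear_combination -h
        exact (mul_ne_zero hz2 h0) this
      · convert h2 using 1
        have : z - (z - 1) * l - z ≠ 0 := by
          have := mul_ne_zero hz2 h0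
          intro h
          exact this (by linear_combination -h)
        field_simp
        ring)
  refine ⟨c, fun u => F ((z - u) / (z - 1)), fun u hu => ?_⟩
  obtain ⟨h1, h2, h3⟩ := hu
  have huz : u - z ≠ 0 := sub_ne_zero.mpr h2
  have hzu : z - u ≠ 0 := sub_ne_zero.mpr (Ne.symm h2)
  have hm : (z - u) / (z - 1) ∈ segmentSlitPlane ((z + 1) / (z - 1)) := by
    refine ⟨div_ne_zero hzu hz2, ?_, ?_⟩
    · convert h1 using 1
      field_simp
      ring
    · convert h3 using 1
      field_simp
      ring
  have hd : HasDerivAt (fun u : ℂ => (z - u) / (z - 1)) (-1 / (z - 1)) u :=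
    ((hasDerivAt_id u).const_sub z).div_const _
  refine ((hF _ hm).comp u hd).congr_deriv ?_
  have : z - (z - 1) * ((z - u) / (z - 1)) = u := by field_simp; ring
  rw [this]
  field_simp
  ring

/-- The involution `t ↦ -1 + 2 (z + 1) / (t + 1)` which exchanges the two cut planes. -/
noncomputable def exchange (z t : ℂ) : ℂ := -1 + 2 * (z + 1) / (t + 1)

lemma exchange_mem_schlafliDomain (hz : z - 1 ∈ Complex.slitPlane) {u : ℂ}
    (hu : u ∈ schendelDomain z) : exchange z u ∈ schlafliDomain z := by
  have hz1 := add_one_ne_zero hz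
  have h0 := schendelDomain_add_one_ne_zero hu
  have h1 := schendelDomain_ne_one hu
  have h2 : u - z ≠ 0 := sub_ne_zero.mpr hu.2.1
  have hne : exchange z u - z = -(z + 1) * (u - 1) / (u + 1) := by
    unfold exchange; field_simp; ring
  refine ⟨?_, ?_, ?_⟩
  · convert two_div_mem_slitPlane hu.1 using 1
    unfold exchange; field_simp; ring
  · rw [← sub_ne_zero, hne]
    exact div_ne_zero (mul_ne_zero (neg_ne_zero.mpr hz1) h1) h0
  · convert two_div_mem_slitPlane hu.2.2 using 1
    rw [hne]
    unfold exchange; field_simp; ring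

lemma exchange_mem_schendelDomain (hz : z - 1 ∈ Complex.slitPlane) {t : ℂ}
    (ht : t ∈ schlafliDomain z) : exchange z t ∈ schendelDomain z := by
  have hz1 := add_one_ne_zero hz
  have h0 := schlafliDomain_add_one_ne_zero ht
  have h1 := schlafliDomain_ne_one ht
  have h2 : t - z ≠ 0 := sub_ne_zero.mpr ht.2.1
  have hne : exchange z t - z = -(z + 1) * (t - 1) / (t + 1) := by
    unfold exchange; field_simp; ring
  refine ⟨?_, ?_, ?_⟩
  · convert two_div_mem_slitPlane ht.1 using 1
    unfold exchange; field_simp; ring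
  · rw [← sub_ne_zero, hne]
    exact div_ne_zero (mul_ne_zero (neg_ne_zero.mpr hz1) h1) h0
  · convert two_div_mem_slitPlane ht.2.2 using 1
    rw [hne]
    unfold exchange; field_simp; ring

lemma hasDerivAt_exchange {t : ℂ} (ht : t + 1 ≠ 0) :
    HasDerivAt (exchange z) (-(2 * (z + 1)) / (t + 1) ^ 2) t := by
  have h := ((hasDerivAt_const t (2 * (z + 1))).div ((hasDerivAt_id t).add_const 1) ht).const_add
    (-1)
  refine h.congr_deriv ?_
  simp

lemma exchange_exchange (hz1 : z + 1 ≠ 0) (t : ℂ) :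
    exchange z (exchange z t) = t := by
  unfold exchange
  have h : -1 + 2 * (z + 1) / (t + 1) + 1 = 2 * (z + 1) / (t + 1) := by ring
  rw [h, div_div_cancel₀ (mul_ne_zero two_ne_zero hz1)]
  ring

theorem exists_primitive_schlafliDomain (hz : z - 1 ∈ Complex.slitPlane) {f : ℂ → ℂ}
    (hf : DifferentiableOn ℂ f (schlafliDomain z)) :
    ∃ (c : ℂ) (F : ℂ → ℂ), ∀ t ∈ schlafliDomain z, HasDerivAt F (f t - c / (t - 1)) t := by
  have hz1 := add_one_ne_zero hz
  obtain ⟨c, F, hF⟩ := exists_primitive_schendelDomain hz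
    (f := fun u => f (exchange z u) * (-(2 * (z + 1)) / (u + 1) ^ 2)) (by
      refine DifferentiableOn.mul ?_ ?_
      · exact hf.comp (fun u hu => (hasDerivAt_exchange
          (schendelDomain_add_one_ne_zero hu)).differentiableAt.differentiableWithinAt)
          fun u hu => exchange_mem_schlafliDomain hz hu
      · refine DifferentiableOn.div (by fun_prop) (by fun_prop) fun u hu => ?_
        exact pow_ne_zero 2 (schendelDomain_add_one_ne_zero hu))
  -- The pole term `c du / (u - z)` pulls back to `c (1 / (t - 1) - 1 / (t + 1)) dt`; the second
  -- part is removed by `log (t + 1)`, which is single-valued here.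
  refine ⟨c, fun t => F (exchange z t) - c * Complex.log (t + 1), fun t ht => ?_⟩
  have h0 := schlafliDomain_add_one_ne_zero ht
  have h1 := schlafliDomain_ne_one ht
  have hlog : HasDerivAt (fun t : ℂ => Complex.log (t + 1)) (1 / (t + 1)) t :=
    ((hasDerivAt_id t).add_const 1).clog ht.1
  refine (((hF _ (exchange_mem_schendelDomain hz ht)).comp t (hasDerivAt_exchange h0)).sub
    (hlog.const_mul c)).congr_deriv ?_
  rw [exchange_exchange hz1 t]
  have hne : exchange z t - z = -(z + 1) * (t - 1) / (t + 1) := by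
    unfold exchange; field_simp; ring
  have hne2 : exchange z t + 1 = 2 * (z + 1) / (t + 1) := by
    unfold exchange; ring
  rw [hne, hne2]
  field_simp
  ring

/-! ### Contour integrals along piecewise `C¹` paths -/

open MeasureTheory in
lemma IsPiecewiseC1.intervalIntegrable_derivWithin {p : ℂ} {C : Path p p}
    (hC : IsPiecewiseC1 C) :
    IntervalIntegrable (derivWithin C.extend (Icc 0 1)) volume 0 1 := by
  obtain ⟨S, hS⟩ := hC
  set g := derivWithin C.extend (Icc 0 1) with hg
  have key : ∀ a b : ℝ, 0 ≤ a → a ≤ b → b ≤ 1 → (∀ s ∈ S, s ∉ Ioo a b) →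
      IntegrableOn g (Icc a b) := by
    intro a b ha hab hb hs
    rcases hab.eq_or_lt with rfl | hab
    · exact IntegrableOn.of_measure_zero (by simp)
    have h1 := (hS a b ha hab hb hs).continuousOn_derivWithin (uniqueDiffOn_Icc hab) le_rfl
    have h2 : IntegrableOn (derivWithin C.extend (Icc a b)) (Ioo a b) :=
      (h1.integrableOn_compact isCompact_Icc).mono_set Ioo_subset_Icc_self
    rw [integrableOn_Icc_iff_integrableOn_Ioo]
    refine h2.congr_fun (fun x hx => ?_) measurableSet_Ioo
    rw [hg, derivWithin_of_mem_nhds (Icc_mem_nhds hx.1 hx.2),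
      derivWithin_of_mem_nhds (Icc_mem_nhds (by linarith [hx.1]) (by linarith [hx.2]))]
  rw [intervalIntegrable_iff_integrableOn_Icc_of_le zero_le_one]
  refine LocallyIntegrableOn.integrableOn_isCompact (fun x hx => ?_) isCompact_Icc
  -- The point `x` may itself be a break point, so it is erased and integrability is shown
  -- separately on its two sides.
  have hnhds : ((S.erase x : Finset ℝ) : Set ℝ)ᶜ ∈ 𝓝 x :=
    (S.erase x).finite_toSet.isClosed.isOpen_compl.mem_nhds (by simp)
  obtain ⟨ε, hε, hball⟩ := Metric.mem_nhds_iff.mp hnhds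
  rw [Real.ball_eq_Ioo] at hball
  have hout : ∀ s ∈ S, s ∈ Ioo (x - ε) (x + ε) → s = x := by
    intro s hs hsx
    by_contra hne
    exact hball hsx (by simp [hne, hs])
  have hl := key (max 0 (x - ε)) x (le_max_left _ _) (max_le hx.1 (by linarith)) hx.2
    (fun s hs h => by
      have := hout s hs ⟨lt_of_le_of_lt (le_max_right _ _) h.1, by linarith [h.2]⟩
      exact h.2.ne this)
  have hr := key x (min 1 (x + ε)) hx.1 (le_min hx.2 (by linarith)) (min_le_left _ _)
    (fun s hs h => by
      have := hout s hs ⟨by linarith [h.1], lt_of_lt_of_le h.2 (min_le_right _ _)⟩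
      exact h.1.ne' this)
  refine ⟨_, ?_, hl.union hr⟩
  filter_upwards [self_mem_nhdsWithin,
    mem_nhdsWithin_of_mem_nhds (Ioo_mem_nhds (by linarith : x - ε < x) (by linarith : x < x + ε))]
    with y hy hy'
  rcases le_total y x with h | h
  · exact Or.inl ⟨max_le hy.1 hy'.1.le, h⟩
  · exact Or.inr ⟨h, le_min hy.2 hy'.2.le⟩

lemma IsPiecewiseC1.hasDerivAt_extend {p : ℂ} {C : Path p p} (hC : IsPiecewiseC1 C) :
    ∃ S : Finset ℝ, ∀ x ∈ Ioo (0 : ℝ) 1 \ S,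
      HasDerivAt C.extend (derivWithin C.extend (Icc 0 1) x) x := by
  obtain ⟨S, hS⟩ := hC
  refine ⟨S, fun x hx => ?_⟩
  obtain ⟨hx, hxS⟩ := hx
  have hnhds : (S : Set ℝ)ᶜ ∩ Ioo 0 1 ∈ 𝓝 x :=
    Filter.inter_mem (S.finite_toSet.isClosed.isOpen_compl.mem_nhds hxS) (Ioo_mem_nhds hx.1 hx.2)
  obtain ⟨ε, hε, hball⟩ := Metric.mem_nhds_iff.mp hnhds
  rw [Real.ball_eq_Ioo] at hball
  have hl : x - ε / 2 ∈ Ioo (x - ε) (x + ε) := ⟨by linarith, by linarith⟩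
  have hr : x + ε / 2 ∈ Ioo (x - ε) (x + ε) := ⟨by linarith, by linarith⟩
  have h := hS (x - ε / 2) (x + ε / 2) (hball hl).2.1.le (by linarith) (hball hr).2.2.le
    (fun s hs h => (hball ⟨by linarith [h.1], by linarith [h.2]⟩).1 hs)
  have hd : DifferentiableAt ℝ C.extend x :=
    (h.differentiableOn one_ne_zero).differentiableAt (Icc_mem_nhds (by linarith) (by linarith))
  rw [derivWithin_of_mem_nhds (Icc_mem_nhds hx.1 hx.2)]
  exact hd.hasDerivAt

lemma contourIntegral_eq {p : ℂ} (C : Path p p) (f : ℂ → ℂ) :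
    contourIntegral C f =
      ∫ s in (0 : ℝ)..1, f (C.extend s) * derivWithin C.extend (Icc 0 1) s := by
  simp [contourIntegral, curveIntegral_def, curveIntegralFun_def, mul_comm]

lemma extend_mem {p : ℂ} {C : Path p p} {U : Set ℂ} (h : ∀ s, C s ∈ U) (s : ℝ) :
    C.extend s ∈ U := by
  obtain ⟨x, hx⟩ : C.extend s ∈ range C := by
    rw [← C.extend_range]; exact mem_range_self s
  rw [← hx]; exact h x

lemma intervalIntegrable_contour {p : ℂ} {C : Path p p} (hC : IsPiecewiseC1 C) {U : Set ℂ}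
    (hU : ∀ s, C s ∈ U) {f : ℂ → ℂ} (hf : ContinuousOn f U) :
    IntervalIntegrable (fun s => f (C.extend s) * derivWithin C.extend (Icc 0 1) s)
      MeasureTheory.volume 0 1 :=
  hC.intervalIntegrable_derivWithin.continuousOn_mul
    (hf.comp_continuous C.continuous_extend (extend_mem hU)).continuousOn

/-- This is the fundamental theorem of calculus off the finite set of break points, applied to `F`
along a closed path. -/
lemma contourIntegral_eq_zero_of_hasDerivAt {p : ℂ} {C : Path p p} (hC : IsPiecewiseC1 C)
    {U : Set ℂ} (hU : ∀ s, C s ∈ U) {f F : ℂ → ℂ} (hf : ContinuousOn f U)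
    (hF : ∀ u ∈ U, HasDerivAt F (f u) u) : contourIntegral C f = 0 := by
  obtain ⟨S, hS⟩ := hC.hasDerivAt_extend
  rw [contourIntegral_eq, MeasureTheory.integral_eq_of_hasDerivAt_off_countable_of_le
    (fun s => F (C.extend s)) _ zero_le_one S.countable_toSet _ _
    (intervalIntegrable_contour hC hU hf)]
  · simp
  · have hFc : ContinuousOn F U := fun u hu => (hF u hu).continuousAt.continuousWithinAt
    exact (hFc.comp_continuous C.continuous_extend (extend_mem hU)).continuousOn
  · intro x hx
    exact (hF _ (extend_mem hU x)).comp x (hS x hx)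

/-- A closed path is integrated by subtracting a simple pole. -/
lemma contourIntegral_eq_of_primitive {p : ℂ} {C : Path p p} (hC : IsPiecewiseC1 C)
    {U : Set ℂ} (hU : ∀ s, C s ∈ U) {f F : ℂ → ℂ} {c a : ℂ} (ha : ∀ u ∈ U, u - a ≠ 0)
    (hf : ContinuousOn f U) (hF : ∀ u ∈ U, HasDerivAt F (f u - c / (u - a)) u)
    (hw : contourIntegral C (fun t => 1 / (t - a)) = 2 * Real.pi * Complex.I) :
    contourIntegral C f = 2 * Real.pi * Complex.I * c := by
  have h1 : ContinuousOn (fun u : ℂ => 1 / (u - a)) U :=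
    continuousOn_const.div (by fun_prop) ha
  have h2 : ContinuousOn (fun u : ℂ => f u - c / (u - a)) U :=
    hf.sub (continuousOn_const.div (by fun_prop) ha)
  have h3 := contourIntegral_eq_zero_of_hasDerivAt hC hU h2 hF
  rw [contourIntegral_eq] at h3 hw ⊢
  have h4 : (fun s => f (C.extend s) * derivWithin C.extend (Icc 0 1) s) = fun s =>
      (f (C.extend s) - c / (C.extend s - a)) * derivWithin C.extend (Icc 0 1) s +
      c * (1 / (C.extend s - a) * derivWithin C.extend (Icc 0 1) s) := by
    funext s; ring
  rw [h4, intervalIntegral.integral_add (intervalIntegrable_contour hC hU h2)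
    ((intervalIntegrable_contour hC hU h1).const_mul c), h3,
    intervalIntegral.integral_const_mul, hw]
  ring

/-! ### A circle which lies in both cut planes -/

lemma mul_mem_slitPlane_of_re_pos {x y : ℂ} (hx : 0 < x.re) (hy : 0 < y.re) :
    x * y ∈ Complex.slitPlane := by
  rw [Complex.mem_slitPlane_iff, Complex.mul_re, Complex.mul_im]
  by_contra! h
  obtain ⟨h1, h2⟩ := h
  have h3 : 0 < x.im * y.im := by nlinarith [mul_pos hx hy]
  have h4 : x.re * (x.im * y.im) + x.im ^ 2 * y.re = 0 := by linear_combination x.im * h2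
  nlinarith [mul_pos hx h3, mul_nonneg (sq_nonneg x.im) hy.le]

lemma log_mul_of_re_pos {x y : ℂ} (hx : 0 < x.re) (hy : 0 < y.re) :
    Complex.log (x * y) = Complex.log x + Complex.log y := by
  have hx0 : x ≠ 0 := fun h => by simp [h] at hx
  have hy0 : y ≠ 0 := fun h => by simp [h] at hy
  have h1 := abs_lt.mp (Complex.abs_arg_lt_pi_div_two_iff.mpr (Or.inl hx))
  have h2 := abs_lt.mp (Complex.abs_arg_lt_pi_div_two_iff.mpr (Or.inl hy))
  exact Complex.log_mul hx0 hy0 ⟨by linarith [h1.1, h2.1], by linarith [h1.2, h2.2]⟩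

lemma inv_re_pos {x : ℂ} (hx : 0 < x.re) : 0 < (x⁻¹).re := by
  have hx0 : x ≠ 0 := fun h => by simp [h] at hx
  rw [Complex.inv_re]
  exact div_pos hx (Complex.normSq_pos.mpr hx0)

lemma log_inv_of_re_pos {x : ℂ} (hx : 0 < x.re) : Complex.log x⁻¹ = -Complex.log x :=
  Complex.log_inv _ (Complex.mem_slitPlane_iff_arg.mp
    (Complex.mem_slitPlane_iff.mpr (Or.inl hx))).1

lemma log_two_mul {x : ℂ} (hx : x ≠ 0) : Complex.log (2 * x) = Complex.log 2 + Complex.log x := by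
  have := Complex.log_ofReal_mul (r := 2) two_pos hx
  rw [Complex.ofReal_log two_pos.le] at this
  simpa using this

lemma two_mul_mem_slitPlane {x : ℂ} (hx : x ∈ Complex.slitPlane) : 2 * x ∈ Complex.slitPlane := by
  rw [Complex.mem_slitPlane_iff] at hx ⊢
  simpa using hx

/-- A circle around `1` and `z` which lies in both cut planes, in a region where the branches of
`ln ((t² - 1) / (t - z))` used in the two planes agree. -/
structure IsCommonCircle (z c : ℂ) (R : ℝ) : Prop where
  pos : 0 < R
  mem_schlafli : ∀ t ∈ Metric.sphere c R, t ∈ schlafliDomain z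
  mem_schendel : ∀ t ∈ Metric.sphere c R, t ∈ schendelDomain z
  log_eq : ∀ t ∈ Metric.sphere c R, rayLog z t + Complex.log ((t - 1) / (t - z)) =
    Complex.log (t + 1) + arcLog z t
  one_mem : 1 ∈ Metric.ball c R
  z_mem : z ∈ Metric.ball c R

lemma norm_sub_ofReal_sq (y : ℂ) (s : ℝ) :
    ‖y - s‖ ^ 2 = Complex.normSq y - 2 * s * y.re + s ^ 2 := by
  rw [← Complex.normSq_eq_norm_sq, Complex.normSq_apply, Complex.normSq_apply]
  simp
  ring

lemma exists_sqrt {z : ℂ} (hz : z - 1 ∈ Complex.slitPlane) :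
    ∃ b : ℂ, 0 < b.re ∧ z + 1 = 2 * (b * b) := by
  have h : (z + 1) / 2 ∈ Complex.slitPlane := by
    have := add_one_mem_slitPlane hz
    rw [Complex.mem_slitPlane_iff] at this ⊢
    have h2 : (z + 1) / 2 = ((1 / 2 : ℝ) : ℂ) * (z + 1) := by push_cast; ring
    rw [h2, Complex.re_ofReal_mul, Complex.im_ofReal_mul]
    rcases this with h | h
    · exact Or.inl (by positivity)
    · exact Or.inr (mul_ne_zero (by norm_num) h)
  refine ⟨Complex.exp (Complex.log ((z + 1) / 2) / 2), ?_, ?_⟩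
  · rw [Complex.exp_re]
    refine mul_pos (Real.exp_pos _) (Real.cos_pos_of_mem_Ioo ?_)
    have h1 := Complex.neg_pi_lt_arg ((z + 1) / 2)
    have h2 := lt_of_le_of_ne (Complex.arg_le_pi _) (Complex.mem_slitPlane_iff_arg.mp h).1
    have h3 : (Complex.log ((z + 1) / 2) / 2).im = Complex.arg ((z + 1) / 2) / 2 := by
      rw [← Complex.log_im]; simp
    rw [h3]
    constructor <;> linarith
  · rw [← Complex.exp_add, add_halves, Complex.exp_log (Complex.slitPlane_ne_zero h)]
    ring

/-- Write `z + 1 = 2 b²` with `Re b > 0` and `t + 1 = 2 b y`. The circle is `|y|² + 1 = s Re y`,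
centred at `s / 2` in the variable `y`. On it `y` and `w = (b y - 1) / (y - b)` have positive real
part. All arguments of logarithms are then, up to a factor 2, products of two numbers from the right
half-plane, so they avoid the cuts and their logarithms split additively. -/
theorem exists_isCommonCircle {z : ℂ} (hz : z - 1 ∈ Complex.slitPlane) :
    ∃ (c : ℂ) (R : ℝ), IsCommonCircle z c R := by
  obtain ⟨b, hb, hzb⟩ := exists_sqrt hz
  have hb0 : b ≠ 0 := fun h => by simp [h] at hb
  have hbn : 0 < Complex.normSq b := Complex.normSq_pos.mpr hb0
  have hbnorm : 0 < ‖b‖ := norm_pos_iff.mpr hb0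
  have hz1 := add_one_ne_zero hz
  -- This makes `|y|² + 1 = (s - 1) Re y` at both `y = b` (`t = z`) and `y = 1 / b` (`t = 1`), so
  -- both points are strictly inside.
  set s : ℝ := (Complex.normSq b + 1) / b.re + 1 with hs
  have hsb : (s - 1) * b.re = Complex.normSq b + 1 := by
    rw [hs]; field_simp; ring
  have hs3 : 3 ≤ s := by
    have h1 : 2 * b.re ≤ (s - 1) * b.re := by
      rw [hsb, Complex.normSq_apply]
      nlinarith [sq_nonneg (b.re - 1), sq_nonneg b.im]
    have := le_of_mul_le_mul_right h1 hb
    linarith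
  have hρ : 0 < s ^ 2 / 4 - 1 := by nlinarith
  set ρ : ℝ := √(s ^ 2 / 4 - 1) with hρdef
  have hρ0 : 0 < ρ := Real.sqrt_pos.mpr hρ
  have hρ2 : ρ ^ 2 = s ^ 2 / 4 - 1 := Real.sq_sqrt hρ.le
  have hdist : ∀ y : ℂ, dist (2 * (b * y) - 1) (b * s - 1) = 2 * ‖b‖ * ‖y - ((s / 2 : ℝ) : ℂ)‖ := by
    intro y
    rw [dist_eq_norm]
    have : 2 * (b * y) - 1 - (b * s - 1) = 2 * b * (y - ((s / 2 : ℝ) : ℂ)) := by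
      push_cast; ring
    rw [this, norm_mul, norm_mul]
    simp
  have hin : ∀ y : ℂ, Complex.normSq y + 1 < s * y.re →
      2 * (b * y) - 1 ∈ Metric.ball (b * s - 1) (2 * ‖b‖ * ρ) := by
    intro y hy
    rw [Metric.mem_ball, hdist]
    refine mul_lt_mul_of_pos_left ?_ (by positivity)
    refine lt_of_pow_lt_pow_left₀ 2 hρ0.le ?_
    rw [norm_sub_ofReal_sq, hρ2]
    nlinarith
  have hon : ∀ t ∈ Metric.sphere (b * s - 1) (2 * ‖b‖ * ρ), ∃ y w : ℂ,
      0 < y.re ∧ 0 < w.re ∧ t ≠ z ∧ t + 1 = 2 * (b * y) ∧ (t - 1) / (t - z) = w * b⁻¹ := by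
    intro t ht
    set y := (t + 1) / (2 * b) with hy
    have hty : t + 1 = 2 * (b * y) := by rw [hy]; field_simp
    have ht' : t = 2 * (b * y) - 1 := by linear_combination hty
    rw [Metric.mem_sphere, ht', hdist] at ht
    have h1 : ‖y - ((s / 2 : ℝ) : ℂ)‖ = ρ := mul_left_cancel₀ (by positivity) ht
    have h2 : Complex.normSq y + 1 = s * y.re := by
      have h3 := norm_sub_ofReal_sq y (s / 2)
      rw [h1, hρ2] at h3
      linarith
    have hyre : 0 < y.re := by
      have := Complex.normSq_nonneg y
      by_contra! h
      nlinarith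
    have hyb : y - b ≠ 0 := by
      intro h
      have : y = b := sub_eq_zero.mp h
      rw [this] at h2
      linarith
    have htz : t - z = 2 * (b * (y - b)) := by linear_combination hty - hzb
    have htz0 : t - z ≠ 0 := by
      rw [htz]; exact mul_ne_zero two_ne_zero (mul_ne_zero hb0 hyb)
    refine ⟨y, (b * y - 1) / (y - b), hyre, ?_, sub_ne_zero.mp htz0, hty, ?_⟩
    · rw [Complex.div_re, ← add_div]
      refine div_pos ?_ (Complex.normSq_pos.mpr hyb)
      -- The left side is the real part of `(b y - 1)` times the conjugate of `y - b`, the numerator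
      -- of `Re w`.
      have h4 : b.re * (Complex.normSq y + 1) - y.re * (Complex.normSq b + 1) = b.re * y.re := by
        rw [h2, ← hsb]; ring
      have h5 : 0 < b.re * y.re := mul_pos hb hyre
      rw [Complex.normSq_apply, Complex.normSq_apply] at h4
      simp only [Complex.sub_re, Complex.mul_re, Complex.one_re, Complex.sub_im, Complex.mul_im,
        Complex.one_im]
      nlinarith
    · have : t - 1 = 2 * (b * y - 1) := by linear_combination hty
      rw [htz, this]
      field_simp
  have hbi := inv_re_pos hb
  refine ⟨b * s - 1, 2 * ‖b‖ * ρ, by positivity, ?_, ?_, ?_, ?_, ?_⟩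
  · intro t ht
    obtain ⟨y, w, hy, hw, htz, h1, h2⟩ := hon t ht
    refine ⟨?_, htz, ?_⟩
    · rw [h1]; exact two_mul_mem_slitPlane (mul_mem_slitPlane_of_re_pos hb hy)
    · have : (z + 1) * (t - 1) / (t - z) = 2 * (b * w) := by
        rw [mul_div_assoc, h2, hzb]; field_simp
      rw [this]; exact two_mul_mem_slitPlane (mul_mem_slitPlane_of_re_pos hb hw)
  · intro t ht
    obtain ⟨y, w, hy, hw, htz, h1, h2⟩ := hon t ht
    refine ⟨?_, htz, ?_⟩
    · have : (t + 1) / (z + 1) = y * b⁻¹ := by rw [h1, hzb]; field_simp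
      rw [this]; exact mul_mem_slitPlane_of_re_pos hy hbi
    · rw [h2]; exact mul_mem_slitPlane_of_re_pos hw hbi
  · intro t ht
    obtain ⟨y, w, hy, hw, htz, h1, h2⟩ := hon t ht
    have hy0 : y ≠ 0 := fun h => by simp [h] at hy
    have hw0 : w ≠ 0 := fun h => by simp [h] at hw
    have h3 : (z + 1) * (t - 1) / (t - z) = 2 * (b * w) := by
      rw [mul_div_assoc, h2, hzb]; field_simp
    have h4 : (t + 1) / (z + 1) = y * b⁻¹ := by rw [h1, hzb]; field_simp
    rw [rayLog, arcLog, h2, h3, h4, h1, hzb, log_two_mul (mul_ne_zero hb0 hy0),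
      log_two_mul (mul_ne_zero hb0 hw0), log_two_mul (mul_ne_zero hb0 hb0),
      log_mul_of_re_pos hb hy, log_mul_of_re_pos hb hw, log_mul_of_re_pos hb hb,
      log_mul_of_re_pos hy hbi, log_mul_of_re_pos hw hbi, log_inv_of_re_pos hb]
    ring
  · have h1 : 2 * (b * b⁻¹) - 1 = 1 := by rw [mul_inv_cancel₀ hb0]; norm_num
    have h2 : 2 * (b * b⁻¹) - 1 ∈ Metric.ball (b * s - 1) (2 * ‖b‖ * ρ) := by
      refine hin _ ?_
      rw [Complex.normSq_inv, Complex.inv_re]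
      have : 0 < b.re / Complex.normSq b := div_pos hb hbn
      have h2 : (Complex.normSq b)⁻¹ + 1 = (s - 1) * (b.re / Complex.normSq b) := by
        rw [← mul_div_assoc, hsb]; field_simp; ring
      rw [h2]
      linarith
    rwa [h1] at h2
  · have h1 : z = 2 * (b * b) - 1 := by linear_combination hzb
    have h2 : 2 * (b * b) - 1 ∈ Metric.ball (b * s - 1) (2 * ‖b‖ * ρ) := hin b (by linarith)
    rw [← h1] at h2
    exact h2

/-! ### Contour integrals as circle integrals -/

lemma circleIntegral_eq_of_primitive {a c k : ℂ} {R : ℝ} (hR : 0 < R) (ha : a ∈ Metric.ball c R)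
    {f F : ℂ → ℂ} (hf : ContinuousOn f (Metric.sphere c R))
    (hF : ∀ u ∈ Metric.sphere c R, HasDerivAt F (f u - k / (u - a)) u) :
    (∮ u in C(c, R), f u) = 2 * Real.pi * Complex.I * k := by
  have hne : ∀ u ∈ Metric.sphere c R, u - a ≠ 0 := fun u hu h => by
    rw [sub_eq_zero.mp h, Metric.mem_sphere] at hu
    rw [Metric.mem_ball] at ha
    linarith
  have h1 : ContinuousOn (fun u : ℂ => k * (u - a)⁻¹) (Metric.sphere c R) :=
    continuousOn_const.mul (ContinuousOn.inv₀ (by fun_prop) hne)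
  have h2 := circleIntegral.integral_eq_zero_of_hasDerivWithinAt hR.le
    fun u hu => (hF u hu).hasDerivWithinAt
  have h3 : (fun u => f u - k / (u - a)) = fun u => f u - k * (u - a)⁻¹ := by
    funext u; rw [div_eq_mul_inv]
  rw [h3, circleIntegral.integral_sub (hf.circleIntegrable hR.le) (h1.circleIntegrable hR.le),
    circleIntegral.integral_const_mul, circleIntegral.integral_sub_inv_of_mem_ball ha,
    sub_eq_zero] at h2
  rw [h2]
  ring

variable {c : ℂ} {R : ℝ}

/-- Both sides equal `2πi` times the same constant `k`, because contour and circle each wind once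
around `1`. In the `u`-plane the pole is placed at `z` instead. -/
theorem contourIntegral_eq_circleIntegral (hz : z - 1 ∈ Complex.slitPlane)
    (hc : IsCommonCircle z c R) {p : ℂ} {C : Path p p} (hC : IsContour z C) {f : ℂ → ℂ}
    (hf : DifferentiableOn ℂ f (schlafliDomain z)) :
    contourIntegral C f = ∮ t in C(c, R), f t := by
  obtain ⟨k, F, hF⟩ := exists_primitive_schlafliDomain hz hf
  rw [circleIntegral_eq_of_primitive hc.pos hc.one_mem (hf.continuousOn.mono hc.mem_schlafli)
    fun u hu => hF u (hc.mem_schlafli u hu)]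
  exact contourIntegral_eq_of_primitive hC.piecewiseC1
    (fun s => mem_schlafliDomain hz (hC.avoids s)) (fun u hu => schlafliDomain_ne_one hu)
    hf.continuousOn hF hC.winding_left

theorem contourIntegral_eq_circleIntegral' (hz : z - 1 ∈ Complex.slitPlane)
    (hc : IsCommonCircle z c R) {p : ℂ} {C : Path p p} (hC : IsContour' z C) {f : ℂ → ℂ}
    (hf : DifferentiableOn ℂ f (schendelDomain z)) :
    contourIntegral C f = ∮ t in C(c, R), f t := by
  obtain ⟨k, F, hF⟩ := exists_primitive_schendelDomain hz hf
  rw [circleIntegral_eq_of_primitive hc.pos hc.z_mem (hf.continuousOn.mono hc.mem_schendel)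
    fun u hu => hF u (hc.mem_schendel u hu)]
  exact contourIntegral_eq_of_primitive hC.piecewiseC1
    (fun s => mem_schendelDomain hz (hC.avoids s)) (fun u hu => sub_ne_zero.mpr hu.2.1)
    hf.continuousOn hF hC.winding_right

/-! ### The kernels -/

/-- The branch of `ln ((t² - 1) / (t - z))` in the `t`-plane. -/
noncomputable def schlafliLog (z t : ℂ) : ℂ := Complex.log (t + 1) + arcLog z t

/-- The branch of `ln ((u² - 1) / (u - z))` in the `u`-plane. -/
noncomputable def schendelLog (z u : ℂ) : ℂ := rayLog z u + Complex.log ((u - 1) / (u - z))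

lemma log_div_two {x : ℂ} (hx : x ≠ 0) : Complex.log (x / 2) = Complex.log x - Complex.log 2 := by
  have := log_two_mul (div_ne_zero hx (two_ne_zero (α := ℂ)))
  rw [mul_div_cancel₀ _ (two_ne_zero (α := ℂ))] at this
  rw [this]
  ring

lemma hasDerivAt_arcLog (hz : z - 1 ∈ Complex.slitPlane) {t : ℂ} (ht : t ∈ schlafliDomain z) :
    HasDerivAt (arcLog z) (1 / (t - 1) - 1 / (t - z)) t := by
  have h1 := schlafliDomain_ne_one ht
  have h2 : t - z ≠ 0 := sub_ne_zero.mpr ht.2.1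
  have hz1 := add_one_ne_zero hz
  have h3 : HasDerivAt (fun t : ℂ => (z + 1) * (t - 1) / (t - z))
      (((z + 1) * (t - z) - (z + 1) * (t - 1)) / (t - z) ^ 2) t := by
    exact ((((hasDerivAt_id t).sub_const 1).const_mul (z + 1)).div
      ((hasDerivAt_id t).sub_const z) h2).congr_deriv (by simp)
  refine ((h3.clog ht.2.2).sub_const (Complex.log (z + 1))).congr_deriv ?_
  field_simp

lemma hasDerivAt_log_add_one {t : ℂ} (ht : t ∈ schlafliDomain z) :
    HasDerivAt (fun t : ℂ => Complex.log (t + 1)) (1 / (t + 1)) t :=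
  ((hasDerivAt_id t).add_const 1).clog ht.1

lemma hasDerivAt_schlafliLog (hz : z - 1 ∈ Complex.slitPlane) {t : ℂ}
    (ht : t ∈ schlafliDomain z) :
    HasDerivAt (schlafliLog z) (1 / (t + 1) + (1 / (t - 1) - 1 / (t - z))) t :=
  (hasDerivAt_log_add_one ht).add (hasDerivAt_arcLog hz ht)

lemma hasDerivAt_rayLog (hz : z - 1 ∈ Complex.slitPlane) {u : ℂ} (hu : u ∈ schendelDomain z) :
    HasDerivAt (rayLog z) (1 / (u + 1)) u := by
  have h0 := schendelDomain_add_one_ne_zero hu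
  have hz1 := add_one_ne_zero hz
  have h3 : HasDerivAt (fun u : ℂ => (u + 1) / (z + 1)) (1 / (z + 1)) u :=
    ((hasDerivAt_id u).add_const 1).div_const _
  refine ((h3.clog hu.1).add_const (Complex.log (z + 1))).congr_deriv ?_
  field_simp

lemma hasDerivAt_log_quotient {u : ℂ} (hu : u ∈ schendelDomain z) :
    HasDerivAt (fun u : ℂ => Complex.log ((u - 1) / (u - z))) (1 / (u - 1) - 1 / (u - z)) u := by
  have h1 := schendelDomain_ne_one hu
  have h2 : u - z ≠ 0 := sub_ne_zero.mpr hu.2.1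
  have h3 : HasDerivAt (fun t : ℂ => (t - 1) / (t - z)) (((u - z) - (u - 1)) / (u - z) ^ 2) u := by
    exact (((hasDerivAt_id u).sub_const 1).div ((hasDerivAt_id u).sub_const z) h2).congr_deriv
      (by simp)
  refine (h3.clog hu.2.2).congr_deriv ?_
  field_simp

lemma hasDerivAt_schendelLog (hz : z - 1 ∈ Complex.slitPlane) {u : ℂ}
    (hu : u ∈ schendelDomain z) :
    HasDerivAt (schendelLog z) (1 / (u + 1) + (1 / (u - 1) - 1 / (u - z))) u :=
  (hasDerivAt_rayLog hz hu).add (hasDerivAt_log_quotient hu)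

lemma differentiableOn_schlafliKernel (hz : z - 1 ∈ Complex.slitPlane) (ν : ℂ) (μ : ℤ) :
    DifferentiableOn ℂ (schlafliKernel ν μ z) (schlafliDomain z) := by
  intro t ht
  refine DifferentiableAt.differentiableWithinAt ?_
  have h2 : t - z ≠ 0 := sub_ne_zero.mpr ht.2.1
  refine DifferentiableAt.mul (((hasDerivAt_schlafliLog hz ht).const_mul ν).cexp).differentiableAt ?_
  exact DifferentiableAt.zpow (by fun_prop) (Or.inl h2)

lemma differentiableOn_schendelKernel (hz : z - 1 ∈ Complex.slitPlane) (ν : ℂ) (μ : ℤ) :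
    DifferentiableOn ℂ (schendelKernel ν μ z) (schendelDomain z) := by
  intro u hu
  refine DifferentiableAt.differentiableWithinAt ?_
  have h0 := schendelDomain_add_one_ne_zero hu
  have h1 := schendelDomain_ne_one hu
  have h2 : u - z ≠ 0 := sub_ne_zero.mpr hu.2.1
  refine DifferentiableAt.div (DifferentiableAt.mul
    (((hasDerivAt_schendelLog hz hu).const_mul ν).cexp).differentiableAt ?_) (by fun_prop) h2
  exact DifferentiableAt.zpow (DifferentiableAt.div (by fun_prop) (by fun_prop) h1)
    (Or.inl (div_ne_zero h0 h1))

lemma differentiableOn_log_half :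
    DifferentiableOn ℂ (fun t => Complex.log ((t + 1) / 2)) (schlafliDomain z) := by
  refine DifferentiableOn.congr (f := fun t => Complex.log (t + 1) - Complex.log 2) ?_
    fun t ht => log_div_two (schlafliDomain_add_one_ne_zero ht)
  exact fun t ht => ((hasDerivAt_log_add_one ht).sub_const _).differentiableAt.differentiableWithinAt

lemma differentiableOn_arcLog (hz : z - 1 ∈ Complex.slitPlane) :
    DifferentiableOn ℂ (arcLog z) (schlafliDomain z) :=
  fun _ ht => (hasDerivAt_arcLog hz ht).differentiableAt.differentiableWithinAt

lemma differentiableOn_rayLog (hz : z - 1 ∈ Complex.slitPlane) :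
    DifferentiableOn ℂ (rayLog z) (schendelDomain z) :=
  fun _ hu => (hasDerivAt_rayLog hz hu).differentiableAt.differentiableWithinAt

lemma differentiableOn_log_quotient :
    DifferentiableOn ℂ (fun u : ℂ => Complex.log ((u - 1) / (u - z))) (schendelDomain z) :=
  fun _ hu => (hasDerivAt_log_quotient hu).differentiableAt.differentiableWithinAt

/-! ### The involution which preserves `(t² - 1) / (t - z)` -/

/-- The involution `t ↦ (z t - 1) / (t - z)`. -/
noncomputable def swap (z t : ℂ) : ℂ := (z * t - 1) / (t - z)

lemma swap_add_one {t : ℂ} (ht : t ≠ z) : swap z t + 1 = (z + 1) * (t - 1) / (t - z) := by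
  have : t - z ≠ 0 := sub_ne_zero.mpr ht
  unfold swap; field_simp; ring

lemma swap_sub_one {t : ℂ} (ht : t ≠ z) : swap z t - 1 = (z - 1) * (t + 1) / (t - z) := by
  have : t - z ≠ 0 := sub_ne_zero.mpr ht
  unfold swap; field_simp; ring

lemma swap_sub_self {t : ℂ} (ht : t ≠ z) : swap z t - z = (z - 1) * (z + 1) / (t - z) := by
  have : t - z ≠ 0 := sub_ne_zero.mpr ht
  unfold swap; field_simp; ring

lemma hasDerivAt_swap {t : ℂ} (ht : t ≠ z) :
    HasDerivAt (swap z) (-((z - 1) * (z + 1) / (t - z) ^ 2)) t := by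
  have h2 : t - z ≠ 0 := sub_ne_zero.mpr ht
  have h : HasDerivAt (swap z) ((z * (t - z) - (z * t - 1)) / (t - z) ^ 2) t := by
    exact ((((hasDerivAt_id t).const_mul z).sub_const 1).div
      ((hasDerivAt_id t).sub_const z) h2).congr_deriv (by simp)
  refine h.congr_deriv ?_
  field_simp
  ring

lemma swap_ne (hz : z - 1 ∈ Complex.slitPlane) {t : ℂ} (ht : t ≠ z) : swap z t ≠ z := by
  rw [← sub_ne_zero, swap_sub_self ht]
  exact div_ne_zero (mul_ne_zero (sub_one_ne_zero hz) (add_one_ne_zero hz)) (sub_ne_zero.mpr ht)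

lemma swap_quotient (hz : z - 1 ∈ Complex.slitPlane) {t : ℂ} (ht : t ≠ z) :
    (swap z t - 1) / (swap z t - z) = (t + 1) / (z + 1) := by
  have h1 := sub_one_ne_zero hz
  have h2 := add_one_ne_zero hz
  have h3 : t - z ≠ 0 := sub_ne_zero.mpr ht
  rw [swap_sub_one ht, swap_sub_self ht]
  field_simp

/-- The involution exchanges the two slit-plane conditions, that is, the half-line with the arc. -/
lemma swap_mem_schlafliDomain (hz : z - 1 ∈ Complex.slitPlane) {t : ℂ}
    (ht : t ∈ schlafliDomain z) : swap z t ∈ schlafliDomain z := by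
  have h2 := add_one_ne_zero hz
  refine ⟨?_, swap_ne hz ht.2.1, ?_⟩
  · rw [swap_add_one ht.2.1]; exact ht.2.2
  · rw [mul_div_assoc, swap_quotient hz ht.2.1, mul_div_cancel₀ _ h2]; exact ht.1

lemma swap_mem_schendelDomain (hz : z - 1 ∈ Complex.slitPlane) {u : ℂ}
    (hu : u ∈ schendelDomain z) : swap z u ∈ schendelDomain z := by
  have h2 := add_one_ne_zero hz
  refine ⟨?_, swap_ne hz hu.2.1, ?_⟩
  · rw [swap_add_one hu.2.1, mul_div_assoc, mul_div_cancel_left₀ _ h2]; exact hu.2.2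
  · rw [swap_quotient hz hu.2.1]; exact hu.1

lemma log_swap_add_one {t : ℂ} (ht : t ≠ z) :
    Complex.log (swap z t + 1) = arcLog z t + Complex.log (z + 1) := by
  rw [swap_add_one ht, arcLog]; ring

lemma arcLog_swap (hz : z - 1 ∈ Complex.slitPlane) {t : ℂ} (ht : t ≠ z) :
    arcLog z (swap z t) = Complex.log (t + 1) - Complex.log (z + 1) := by
  rw [arcLog, mul_div_assoc, swap_quotient hz ht, mul_div_cancel₀ _ (add_one_ne_zero hz)]

lemma rayLog_swap (hz : z - 1 ∈ Complex.slitPlane) {u : ℂ} (hu : u ≠ z) :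
    rayLog z (swap z u) = Complex.log ((u - 1) / (u - z)) + Complex.log (z + 1) := by
  rw [rayLog, swap_add_one hu, mul_div_assoc, mul_div_cancel_left₀ _ (add_one_ne_zero hz)]

lemma log_quotient_swap (hz : z - 1 ∈ Complex.slitPlane) {u : ℂ} (hu : u ≠ z) :
    Complex.log ((swap z u - 1) / (swap z u - z)) = rayLog z u - Complex.log (z + 1) := by
  rw [rayLog, swap_quotient hz hu]; ring

/-- The exponent is invariant since `swap` interchanges the two logarithms up to `log (z + 1)`; only
the powers of `t - z` and the Jacobian change. -/
lemma schlafliKernel_swap (hz : z - 1 ∈ Complex.slitPlane) (ν : ℂ) (μ : ℤ) {t : ℂ} (ht : t ≠ z) :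
    schlafliKernel ν (-μ) z (swap z t) * ((z - 1) * (z + 1) / (t - z) ^ 2) =
      ((z - 1) * (z + 1)) ^ μ * schlafliKernel ν μ z t := by
  have h1 : (z - 1) * (z + 1) ≠ 0 := mul_ne_zero (sub_one_ne_zero hz) (add_one_ne_zero hz)
  have h3 : t - z ≠ 0 := sub_ne_zero.mpr ht
  have hE : Complex.log (swap z t + 1) + arcLog z (swap z t) =
      Complex.log (t + 1) + arcLog z t := by
    rw [log_swap_add_one ht, arcLog_swap hz ht]; ring
  have h4 : -(-μ + 1) = μ - 1 := by ring
  have h5 : (t - z) ^ (-(μ + 1)) = ((t - z) ^ (μ - 1))⁻¹ / (t - z) ^ 2 := by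
    rw [show -(μ + 1) = -(μ - 1) - 2 by ring, zpow_sub₀ h3, zpow_neg]
    norm_cast
  rw [schlafliKernel, schlafliKernel, hE, swap_sub_self ht, h4, h5, div_zpow, zpow_sub_one₀ h1]
  have h7 : (t - z) ^ (μ - 1) ≠ 0 := zpow_ne_zero _ h3
  field_simp
  exact div_self h1

lemma schendelKernel_swap (hz : z - 1 ∈ Complex.slitPlane) (ν : ℂ) (μ : ℤ) {u : ℂ}
    (hu : u ∈ schendelDomain z) :
    schendelKernel ν (-μ) z (swap z u) * ((z - 1) * (z + 1) / (u - z) ^ 2) =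
      ((z - 1) / (z + 1)) ^ μ * schendelKernel ν μ z u := by
  have hz1 := sub_one_ne_zero hz
  have hz2 := add_one_ne_zero hz
  have h0 := schendelDomain_add_one_ne_zero hu
  have h1 := schendelDomain_ne_one hu
  have h3 : u - z ≠ 0 := sub_ne_zero.mpr hu.2.1
  have hE : rayLog z (swap z u) + Complex.log ((swap z u - 1) / (swap z u - z)) =
      rayLog z u + Complex.log ((u - 1) / (u - z)) := by
    rw [rayLog_swap hz hu.2.1, log_quotient_swap hz hu.2.1]; ring
  have h4 : ((swap z u + 1) / (swap z u - 1)) ^ (-μ) =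
      ((z - 1) / (z + 1)) ^ μ * ((u + 1) / (u - 1)) ^ μ := by
    rw [← mul_zpow, zpow_neg, ← inv_zpow, swap_add_one hu.2.1, swap_sub_one hu.2.1]
    congr 1
    field_simp
  rw [schendelKernel, schendelKernel, hE, swap_sub_self hu.2.1, h4]
  field_simp

/-- A change of variables done on primitives: `swap` turns `k / (t - 1)` into a pole term at `z`
with the same coefficient `k`, plus a multiple of `1 / (t + 1)` absorbed by `log (t + 1)`. The image
circle is traversed in the opposite sense, which the sign of the derivative of `swap` compensates.
-/
lemma circleIntegral_swap (hz : z - 1 ∈ Complex.slitPlane) (hc : IsCommonCircle z c R) {f : ℂ → ℂ}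
    (hf : DifferentiableOn ℂ f (schlafliDomain z)) :
    (∮ t in C(c, R), f t) =
      ∮ t in C(c, R), f (swap z t) * ((z - 1) * (z + 1) / (t - z) ^ 2) := by
  obtain ⟨k, F, hF⟩ := exists_primitive_schlafliDomain hz hf
  rw [circleIntegral_eq_of_primitive hc.pos hc.one_mem (hf.continuousOn.mono hc.mem_schlafli)
    fun u hu => hF u (hc.mem_schlafli u hu)]
  refine (circleIntegral_eq_of_primitive hc.pos hc.z_mem
    (F := fun t => -F (swap z t) - k * Complex.log (t + 1)) ?_ ?_).symm
  · refine ContinuousOn.mono (s := schlafliDomain z) ?_ hc.mem_schlafli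
    refine ContinuousOn.mul (hf.continuousOn.comp (fun t ht =>
      (hasDerivAt_swap ht.2.1).continuousAt.continuousWithinAt)
      fun t ht => swap_mem_schlafliDomain hz ht) ?_
    exact continuousOn_const.div (by fun_prop) fun t ht => pow_ne_zero 2 (sub_ne_zero.mpr ht.2.1)
  · intro t ht
    have ht := hc.mem_schlafli t ht
    have hz1 := sub_one_ne_zero hz
    have hz2 := add_one_ne_zero hz
    have h0 := schlafliDomain_add_one_ne_zero ht
    have h3 : t - z ≠ 0 := sub_ne_zero.mpr ht.2.1
    refine (((hF _ (swap_mem_schlafliDomain hz ht)).comp t (hasDerivAt_swap ht.2.1)).neg.sub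
      ((hasDerivAt_log_add_one ht).const_mul k)).congr_deriv ?_
    rw [swap_sub_one ht.2.1]
    field_simp
    ring

lemma circleIntegral_swap' (hz : z - 1 ∈ Complex.slitPlane) (hc : IsCommonCircle z c R)
    {f : ℂ → ℂ} (hf : DifferentiableOn ℂ f (schendelDomain z)) :
    (∮ t in C(c, R), f t) =
      ∮ t in C(c, R), f (swap z t) * ((z - 1) * (z + 1) / (t - z) ^ 2) := by
  obtain ⟨k, F, hF⟩ := exists_primitive_schendelDomain hz hf
  rw [circleIntegral_eq_of_primitive hc.pos hc.z_mem (hf.continuousOn.mono hc.mem_schendel)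
    fun u hu => hF u (hc.mem_schendel u hu)]
  refine (circleIntegral_eq_of_primitive hc.pos hc.z_mem (F := fun t => -F (swap z t)) ?_ ?_).symm
  · refine ContinuousOn.mono (s := schendelDomain z) ?_ hc.mem_schendel
    refine ContinuousOn.mul (hf.continuousOn.comp (fun t ht =>
      (hasDerivAt_swap ht.2.1).continuousAt.continuousWithinAt)
      fun t ht => swap_mem_schendelDomain hz ht) ?_
    exact continuousOn_const.div (by fun_prop) fun t ht => pow_ne_zero 2 (sub_ne_zero.mpr ht.2.1)
  · intro t ht
    have ht := hc.mem_schendel t ht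
    have hz1 := sub_one_ne_zero hz
    have hz2 := add_one_ne_zero hz
    have h3 : t - z ≠ 0 := sub_ne_zero.mpr ht.2.1
    refine ((hF _ (swap_mem_schendelDomain hz ht)).comp t
      (hasDerivAt_swap ht.2.1)).neg.congr_deriv ?_
    rw [swap_sub_self ht.2.1]
    field_simp

theorem circleIntegral_schlafliKernel_neg (hz : z - 1 ∈ Complex.slitPlane)
    (hc : IsCommonCircle z c R) (ν : ℂ) (μ : ℤ) :
    (∮ t in C(c, R), schlafliKernel ν (-μ) z t) =
      ((z - 1) * (z + 1)) ^ μ * ∮ t in C(c, R), schlafliKernel ν μ z t := by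
  rw [circleIntegral_swap hz hc (differentiableOn_schlafliKernel hz ν (-μ)),
    ← circleIntegral.integral_const_mul]
  exact circleIntegral.integral_congr hc.pos.le fun t ht =>
    schlafliKernel_swap hz ν μ (hc.mem_schlafli t ht).2.1

theorem circleIntegral_schlafliKernel_neg_log (hz : z - 1 ∈ Complex.slitPlane)
    (hc : IsCommonCircle z c R) (ν : ℂ) (μ : ℤ) :
    (∮ t in C(c, R), schlafliKernel ν (-μ) z t * Complex.log ((t + 1) / 2)) =
      ((z - 1) * (z + 1)) ^ μ * ∮ t in C(c, R), schlafliKernel ν μ z t *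
        (arcLog z t + Complex.log ((z + 1) / 2)) := by
  rw [circleIntegral_swap hz hc (f := fun t => schlafliKernel ν (-μ) z t *
    Complex.log ((t + 1) / 2)) ((differentiableOn_schlafliKernel hz ν (-μ)).mul
    differentiableOn_log_half), ← circleIntegral.integral_const_mul]
  refine circleIntegral.integral_congr hc.pos.le fun t ht => ?_
  have ht := hc.mem_schlafli t ht
  have h := schlafliKernel_swap hz ν μ ht.2.1
  have h2 := schlafliDomain_add_one_ne_zero (swap_mem_schlafliDomain hz ht)
  simp only [log_div_two h2, log_swap_add_one ht.2.1, log_div_two (add_one_ne_zero hz)]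
  linear_combination (arcLog z t + Complex.log (z + 1) - Complex.log 2) * h

theorem circleIntegral_schendelKernel_neg (hz : z - 1 ∈ Complex.slitPlane)
    (hc : IsCommonCircle z c R) (ν : ℂ) (μ : ℤ) :
    (∮ t in C(c, R), schendelKernel ν (-μ) z t) =
      ((z - 1) / (z + 1)) ^ μ * ∮ t in C(c, R), schendelKernel ν μ z t := by
  rw [circleIntegral_swap' hz hc (differentiableOn_schendelKernel hz ν (-μ)),
    ← circleIntegral.integral_const_mul]
  exact circleIntegral.integral_congr hc.pos.le fun t ht =>
    schendelKernel_swap hz ν μ (hc.mem_schendel t ht)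

theorem circleIntegral_schendelKernel_neg_log (hz : z - 1 ∈ Complex.slitPlane)
    (hc : IsCommonCircle z c R) (ν : ℂ) (μ : ℤ) :
    (∮ u in C(c, R), schendelKernel ν (-μ) z u * (rayLog z u - Complex.log 2)) =
      ((z - 1) / (z + 1)) ^ μ * ∮ u in C(c, R), schendelKernel ν μ z u *
        (Complex.log ((u - 1) / (u - z)) + Complex.log ((z + 1) / 2)) := by
  rw [circleIntegral_swap' hz hc (f := fun u => schendelKernel ν (-μ) z u *
    (rayLog z u - Complex.log 2)) ((differentiableOn_schendelKernel hz ν (-μ)).mul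
    ((differentiableOn_rayLog hz).sub_const (Complex.log 2))), ← circleIntegral.integral_const_mul]
  refine circleIntegral.integral_congr hc.pos.le fun u hu => ?_
  have hu := hc.mem_schendel u hu
  have h := schendelKernel_swap hz ν μ hu
  simp only [rayLog_swap hz hu.2.1, log_div_two (add_one_ne_zero hz)]
  linear_combination (Complex.log ((u - 1) / (u - z)) + Complex.log (z + 1) - Complex.log 2) * h

/-! ### Contiguous relations -/

lemma schlafliKernel_eq (ν : ℂ) (μ : ℤ) (z t : ℂ) :
    schlafliKernel ν μ z t = Complex.exp (ν * schlafliLog z t) * (t - z) ^ (-(μ + 1)) := rfl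

lemma schendelKernel_eq (ν : ℂ) (μ : ℤ) (z u : ℂ) : schendelKernel ν μ z u =
    Complex.exp (ν * schendelLog z u) * ((u + 1) / (u - 1)) ^ μ / (u - z) := rfl

lemma circleIntegrable_schlafliKernel (hz : z - 1 ∈ Complex.slitPlane)
    (hc : IsCommonCircle z c R) (ν : ℂ) (μ : ℤ) : CircleIntegrable (schlafliKernel ν μ z) c R :=
  ((differentiableOn_schlafliKernel hz ν μ).continuousOn.mono hc.mem_schlafli).circleIntegrable
    hc.pos.le

lemma circleIntegrable_schendelKernel (hz : z - 1 ∈ Complex.slitPlane)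
    (hc : IsCommonCircle z c R) (ν : ℂ) (μ : ℤ) : CircleIntegrable (schendelKernel ν μ z) c R :=
  ((differentiableOn_schendelKernel hz ν μ).continuousOn.mono hc.mem_schendel).circleIntegrable
    hc.pos.le

lemma circleIntegral_combination {f₁ f₂ f₃ : ℂ → ℂ} (h₁ : CircleIntegrable f₁ c R)
    (h₂ : CircleIntegrable f₂ c R) (h₃ : CircleIntegrable f₃ c R) (a₁ a₂ a₃ : ℂ) :
    (∮ t in C(c, R), (a₁ * f₁ t + a₂ * f₂ t + a₃ * f₃ t)) =
      a₁ * (∮ t in C(c, R), f₁ t) + a₂ * (∮ t in C(c, R), f₂ t) + a₃ * ∮ t in C(c, R), f₃ t := by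
  have e₁ : CircleIntegrable (fun t => a₁ * f₁ t) c R := h₁.const_smul (a := a₁)
  have e₂ : CircleIntegrable (fun t => a₂ * f₂ t) c R := h₂.const_smul (a := a₂)
  have e₃ : CircleIntegrable (fun t => a₃ * f₃ t) c R := h₃.const_smul (a := a₃)
  have e₁₂ : CircleIntegrable (fun t => a₁ * f₁ t + a₂ * f₂ t) c R := e₁.add e₂
  rw [circleIntegral.integral_add e₁₂ e₃, circleIntegral.integral_add e₁ e₂]
  simp only [circleIntegral.integral_const_mul]

/-- The combined integrand is the derivative of `exp (ν L) (t² - 1) (t - z) ^ (-(μ + 1))`,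
single-valued on the circle. -/
theorem schlafli_recurrence (hz : z - 1 ∈ Complex.slitPlane) (hc : IsCommonCircle z c R) (ν : ℂ)
    (μ : ℤ) :
    (ν - μ + 1) * (∮ t in C(c, R), schlafliKernel ν (μ - 1) z t) +
      (-2 * μ * z) * (∮ t in C(c, R), schlafliKernel ν μ z t) +
      (-(ν + μ + 1) * ((z - 1) * (z + 1))) * (∮ t in C(c, R), schlafliKernel ν (μ + 1) z t) =
        0 := by
  rw [← circleIntegral_combination (circleIntegrable_schlafliKernel hz hc ν (μ - 1))
    (circleIntegrable_schlafliKernel hz hc ν μ) (circleIntegrable_schlafliKernel hz hc ν (μ + 1))]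
  refine circleIntegral.integral_eq_zero_of_hasDerivWithinAt hc.pos.le (f := fun t =>
    Complex.exp (ν * schlafliLog z t) * (((t - 1) * (t + 1)) * (t - z) ^ (-(μ + 1))))
    fun t ht => HasDerivAt.hasDerivWithinAt ?_
  have ht := hc.mem_schlafli t ht
  have h0 := schlafliDomain_add_one_ne_zero ht
  have h1 := schlafliDomain_ne_one ht
  have h3 : t - z ≠ 0 := sub_ne_zero.mpr ht.2.1
  have hpow : HasDerivAt (fun t : ℂ => (t - z) ^ (-(μ + 1)))
      (((-(μ + 1) : ℤ) : ℂ) * (t - z) ^ (-(μ + 1) - 1)) t := by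
    have := (hasDerivAt_zpow (-(μ + 1)) (t - z) (Or.inl h3)).comp t
      ((hasDerivAt_id t).sub_const z)
    exact this.congr_deriv (by simp)
  have hpoly : HasDerivAt (fun t : ℂ => (t - 1) * (t + 1)) (2 * t) t :=
    (((hasDerivAt_id t).sub_const 1).mul ((hasDerivAt_id t).add_const 1)).congr_deriv
      (by simp; ring)
  refine ((((hasDerivAt_schlafliLog hz ht).const_mul ν).cexp).mul (hpoly.mul hpow)).congr_deriv ?_
  simp only [schlafliKernel_eq, Pi.mul_apply]
  have e1 : (t - z) ^ (-(μ - 1 + 1)) = (t - z) ^ (-(μ + 1)) * (t - z) := by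
    rw [← zpow_add_one₀ h3]; congr 1; ring
  have e2 : (t - z) ^ (-(μ + 1 + 1)) = (t - z) ^ (-(μ + 1)) / (t - z) := by
    rw [div_eq_mul_inv, ← zpow_sub_one₀ h3]; congr 1; ring
  have e3 : (t - z) ^ (-(μ + 1) - 1) = (t - z) ^ (-(μ + 1)) / (t - z) := by
    rw [div_eq_mul_inv, ← zpow_sub_one₀ h3]
  rw [e1, e2, e3]
  push_cast
  field_simp
  ring

/-- The combined integrand is the derivative of `-2 exp (ν L) ((t + 1) / (t - 1)) ^ μ`. -/
theorem schendel_recurrence (hz : z - 1 ∈ Complex.slitPlane) (hc : IsCommonCircle z c R) (ν : ℂ)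
    (μ : ℤ) :
    ((ν - μ) * (z - 1)) * (∮ t in C(c, R), schendelKernel ν (μ + 1) z t) +
      (2 * μ * z) * (∮ t in C(c, R), schendelKernel ν μ z t) +
      (-(ν + μ) * (z + 1)) * (∮ t in C(c, R), schendelKernel ν (μ - 1) z t) = 0 := by
  rw [← circleIntegral_combination (circleIntegrable_schendelKernel hz hc ν (μ + 1))
    (circleIntegrable_schendelKernel hz hc ν μ) (circleIntegrable_schendelKernel hz hc ν (μ - 1))]
  refine circleIntegral.integral_eq_zero_of_hasDerivWithinAt hc.pos.le (f := fun t =>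
    Complex.exp (ν * schendelLog z t) * (-2 * ((t + 1) / (t - 1)) ^ μ))
    fun t ht => HasDerivAt.hasDerivWithinAt ?_
  have ht := hc.mem_schendel t ht
  have h0 := schendelDomain_add_one_ne_zero ht
  have h1 := schendelDomain_ne_one ht
  have h3 : t - z ≠ 0 := sub_ne_zero.mpr ht.2.1
  have hρ : (t + 1) / (t - 1) ≠ 0 := div_ne_zero h0 h1
  have hquot : HasDerivAt (fun t : ℂ => (t + 1) / (t - 1)) (-2 / (t - 1) ^ 2) t :=
    (((hasDerivAt_id t).add_const 1).div ((hasDerivAt_id t).sub_const 1) h1).congr_deriv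
      (by simp; ring)
  have hpow : HasDerivAt (fun t : ℂ => ((t + 1) / (t - 1)) ^ μ)
      ((μ : ℂ) * ((t + 1) / (t - 1)) ^ (μ - 1) * (-2 / (t - 1) ^ 2)) t :=
    HasDerivAt.comp (h₂ := fun x : ℂ => x ^ μ) t (hasDerivAt_zpow μ _ (Or.inl hρ)) hquot
  refine ((((hasDerivAt_schendelLog hz ht).const_mul ν).cexp).mul
    (hpow.const_mul (-2))).congr_deriv ?_
  simp only [schendelKernel_eq]
  rw [zpow_add_one₀ hρ, zpow_sub_one₀ hρ]
  generalize ((t + 1) / (t - 1)) ^ μ = q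
  field_simp
  ring

/-! ### Comparison of the integrals in the two planes -/

lemma circleIntegral_schendelKernel_zero (hc : IsCommonCircle z c R) (ν : ℂ) :
    (∮ t in C(c, R), schendelKernel ν 0 z t) = ∮ t in C(c, R), schlafliKernel ν 0 z t := by
  refine circleIntegral.integral_congr hc.pos.le fun t ht => ?_
  have h : schendelLog z t = schlafliLog z t := hc.log_eq t ht
  simp only [schlafliKernel_eq, schendelKernel_eq, h]
  simp [div_eq_mul_inv]

/-- The difference of the integrands is the derivative of `exp (ν L) (t + 1) / (t - z)`; agreement
of the two branches of `L` on the circle is essential. -/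
lemma circleIntegral_schendelKernel_one (hz : z - 1 ∈ Complex.slitPlane)
    (hc : IsCommonCircle z c R) (ν : ℂ) :
    ν * (∮ t in C(c, R), schendelKernel ν 1 z t) =
      (ν + 1) * (z + 1) * ∮ t in C(c, R), schlafliKernel ν 1 z t := by
  rw [← sub_eq_zero, ← circleIntegral.integral_const_mul, ← circleIntegral.integral_const_mul]
  have e₁ : CircleIntegrable (fun t => ν * schendelKernel ν 1 z t) c R :=
    (circleIntegrable_schendelKernel hz hc ν 1).const_smul (a := ν)
  have e₂ : CircleIntegrable (fun t => (ν + 1) * (z + 1) * schlafliKernel ν 1 z t) c R :=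
    (circleIntegrable_schlafliKernel hz hc ν 1).const_smul (a := (ν + 1) * (z + 1))
  rw [← circleIntegral.integral_sub e₁ e₂]
  refine circleIntegral.integral_eq_zero_of_hasDerivWithinAt hc.pos.le (f := fun t =>
    Complex.exp (ν * schlafliLog z t) * ((t + 1) / (t - z)))
    fun t ht => HasDerivAt.hasDerivWithinAt ?_
  have h : schendelLog z t = schlafliLog z t := hc.log_eq t ht
  have ht := hc.mem_schlafli t ht
  have h0 := schlafliDomain_add_one_ne_zero ht
  have h1 := schlafliDomain_ne_one ht
  have h3 : t - z ≠ 0 := sub_ne_zero.mpr ht.2.1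
  have hquot : HasDerivAt (fun t : ℂ => (t + 1) / (t - z)) (-(z + 1) / (t - z) ^ 2) t :=
    (((hasDerivAt_id t).add_const 1).div ((hasDerivAt_id t).sub_const z) h3).congr_deriv
      (by simp; ring)
  refine ((((hasDerivAt_schlafliLog hz ht).const_mul ν).cexp).mul hquot).congr_deriv ?_
  simp only [schlafliKernel_eq, schendelKernel_eq, h]
  have e3 : (t - z) ^ (-((1 : ℤ) + 1)) = 1 / (t - z) ^ 2 := by
    rw [zpow_neg, one_div]; norm_cast
  rw [e3, zpow_one]
  field_simp
  ring

/-- The factors `ν (ν - 1) ⋯ (ν - m + 1)`. -/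
noncomputable def fallingProd (ν : ℂ) (m : ℕ) : ℂ := ∏ j ∈ Finset.range m, (ν - j)

/-- The factors `(ν + 1) (ν + 2) ⋯ (ν + m)`. -/
noncomputable def risingProd (ν : ℂ) (m : ℕ) : ℂ := ∏ j ∈ Finset.range m, (ν + 1 + j)

lemma fallingProd_succ (ν : ℂ) (m : ℕ) : fallingProd ν (m + 1) = fallingProd ν m * (ν - m) :=
  Finset.prod_range_succ _ _

lemma risingProd_succ (ν : ℂ) (m : ℕ) : risingProd ν (m + 1) = risingProd ν m * (ν + 1 + m) :=
  Finset.prod_range_succ _ _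

/-- The products absorb the coefficients of the two recurrences, making them the same recurrence in
`m`. Keeping the products instead of their quotient makes the identity valid for every `ν`. -/
theorem schendel_eq_schlafli (hz : z - 1 ∈ Complex.slitPlane) (hc : IsCommonCircle z c R) (ν : ℂ)
    (m : ℕ) :
    fallingProd ν m * (∮ t in C(c, R), schendelKernel ν m z t) =
      risingProd ν m * (z + 1) ^ m * ∮ t in C(c, R), schlafliKernel ν m z t := by
  induction m using Nat.twoStepInduction with
  | zero => simpa [fallingProd, risingProd] using circleIntegral_schendelKernel_zero hc ν
  | one => simpa [fallingProd, risingProd] using circleIntegral_schendelKernel_one hz hc ν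
  | more m ih0 ih1 =>
    have hz1 := sub_one_ne_zero hz
    have hI := schlafli_recurrence hz hc ν (m + 1)
    have hJ := schendel_recurrence hz hc ν (m + 1)
    have c1 : ((m : ℤ) + 1 - 1) = m := by ring
    have c2 : ((m : ℤ) + 1 + 1) = ((m + 2 : ℕ) : ℤ) := by push_cast; ring
    have c3 : ((m : ℤ) + 1) = ((m + 1 : ℕ) : ℤ) := by push_cast; ring
    rw [c1, c2, c3] at hI hJ
    -- The highest-order term carries the factor `z - 1` in both recurrences.
    refine mul_left_cancel₀ hz1 ?_
    rw [fallingProd_succ, risingProd_succ]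
    rw [fallingProd_succ, risingProd_succ] at *
    push_cast at *
    set D := fallingProd ν m
    set A := risingProd ν m
    linear_combination D * (ν - m) * hJ + A * (ν + 1 + m) * (z + 1) ^ (m + 1) * hI -
      2 * (m + 1) * z * ih1 + (ν + m + 1) * (ν - m) * (z + 1) * ih0

/-! ### Dependence on the degree -/

lemma hasDerivAt_integral_exp {l g : ℝ → ℂ} (hl : Continuous l) (hg : Continuous g) (a b : ℝ)
    (ν : ℂ) :
    HasDerivAt (fun ν : ℂ => ∫ θ in a..b, g θ * Complex.exp (ν * l θ))
      (∫ θ in a..b, g θ * (Complex.exp (ν * l θ) * l θ)) ν := by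
  refine (intervalIntegral.hasDerivAt_integral_of_dominated_loc_of_deriv_le
    (F := fun ν θ => g θ * Complex.exp (ν * l θ))
    (F' := fun ν θ => g θ * (Complex.exp (ν * l θ) * l θ))
    (bound := fun θ => ‖g θ‖ * (Real.exp ((‖ν‖ + 1) * ‖l θ‖) * ‖l θ‖))
    (Metric.ball_mem_nhds ν one_pos) ?_ ?_ ?_ ?_ ?_ ?_).2
  · exact Eventually.of_forall fun x => (by fun_prop : Continuous _).aestronglyMeasurable
  · exact (by fun_prop : Continuous _).intervalIntegrable _ _
  · exact (by fun_prop : Continuous _).aestronglyMeasurable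
  · refine Eventually.of_forall fun θ _ x hx => ?_
    rw [norm_mul, norm_mul, Complex.norm_exp]
    have h1 : ‖x‖ ≤ ‖ν‖ + 1 := by
      have := norm_sub_norm_le x ν
      rw [Metric.mem_ball, dist_eq_norm] at hx
      linarith
    have h2 : (x * l θ).re ≤ (‖ν‖ + 1) * ‖l θ‖ :=
      (Complex.re_le_norm _).trans (by rw [norm_mul]; gcongr)
    gcongr
  · exact (by fun_prop : Continuous _).intervalIntegrable _ _
  · refine Eventually.of_forall fun θ _ x _ => ?_
    refine ((((hasDerivAt_id x).mul_const (l θ)).cexp).const_mul (g θ)).congr_deriv ?_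
    simp

lemma hasDerivAt_circleIntegral_exp {L h : ℂ → ℂ} (hR : 0 ≤ R)
    (hL : ContinuousOn L (Metric.sphere c R)) (hh : ContinuousOn h (Metric.sphere c R)) (ν : ℂ) :
    HasDerivAt (fun ν : ℂ => ∮ t in C(c, R), Complex.exp (ν * L t) * h t)
      (∮ t in C(c, R), Complex.exp (ν * L t) * h t * L t) ν := by
  have hmem : ∀ θ, circleMap c R θ ∈ Metric.sphere c R := circleMap_mem_sphere c hR
  have hl : Continuous fun θ => L (circleMap c R θ) :=
    hL.comp_continuous (continuous_circleMap c R) hmem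
  have hg : Continuous fun θ => deriv (circleMap c R) θ * h (circleMap c R θ) := by
    simp only [deriv_circleMap]
    exact ((continuous_circleMap 0 R).mul continuous_const).mul
      (hh.comp_continuous (continuous_circleMap c R) hmem)
  have := hasDerivAt_integral_exp hl hg 0 (2 * Real.pi) ν
  simp only [circleIntegral, smul_eq_mul]
  convert this using 1
  · funext ν
    refine intervalIntegral.integral_congr fun θ _ => ?_
    ring
  · refine intervalIntegral.integral_congr fun θ _ => ?_
    ring

theorem hasDerivAt_circleIntegral_schlafliKernel (hz : z - 1 ∈ Complex.slitPlane)
    (hc : IsCommonCircle z c R) (ν : ℂ) (μ : ℤ) :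
    HasDerivAt (fun ν => ∮ t in C(c, R), schlafliKernel ν μ z t)
      (∮ t in C(c, R), schlafliKernel ν μ z t * schlafliLog z t) ν := by
  refine hasDerivAt_circleIntegral_exp hc.pos.le (h := fun t => (t - z) ^ (-(μ + 1)))
    (fun t ht => (hasDerivAt_schlafliLog hz
      (hc.mem_schlafli t ht)).continuousAt.continuousWithinAt) ?_ ν
  exact ContinuousOn.zpow₀ (by fun_prop) _
    fun t ht => Or.inl (sub_ne_zero.mpr (hc.mem_schlafli t ht).2.1)

theorem hasDerivAt_circleIntegral_schendelKernel (hz : z - 1 ∈ Complex.slitPlane)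
    (hc : IsCommonCircle z c R) (ν : ℂ) (μ : ℤ) :
    HasDerivAt (fun ν => ∮ t in C(c, R), schendelKernel ν μ z t)
      (∮ t in C(c, R), schendelKernel ν μ z t * schendelLog z t) ν := by
  have h := hasDerivAt_circleIntegral_exp hc.pos.le (L := schendelLog z)
    (h := fun u => ((u + 1) / (u - 1)) ^ μ / (u - z))
    (fun t ht => (hasDerivAt_schendelLog hz
      (hc.mem_schendel t ht)).continuousAt.continuousWithinAt) (by
      refine ContinuousOn.div ?_ (by fun_prop)
        fun t ht => sub_ne_zero.mpr (hc.mem_schendel t ht).2.1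
      refine ContinuousOn.zpow₀ (ContinuousOn.div (by fun_prop) (by fun_prop)
        fun t ht => schendelDomain_ne_one (hc.mem_schendel t ht)) _ fun t ht => Or.inl ?_
      exact div_ne_zero (schendelDomain_add_one_ne_zero (hc.mem_schendel t ht))
        (schendelDomain_ne_one (hc.mem_schendel t ht))) ν
  simp only [schendelKernel_eq, mul_div_assoc]
  exact h

/-! ### Gamma factors -/

lemma IsGammaPole.ne {s : ℂ} (hs : ¬ IsGammaPole s) (n : ℕ) : s ≠ -n := fun h => hs ⟨n, h⟩

/-- Poles differ by integers, so a ball of radius `1 / 2` contains at most one. -/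
lemma eventually_not_isGammaPole_punctured (s ν : ℂ) :
    ∀ᶠ w in 𝓝[≠] ν, ¬ IsGammaPole (w + s) := by
  have huniq : ∀ w₁ ∈ Metric.ball ν (1 / 2), ∀ w₂ ∈ Metric.ball ν (1 / 2),
      IsGammaPole (w₁ + s) → IsGammaPole (w₂ + s) → w₁ = w₂ := by
    rintro w₁ h₁ w₂ h₂ ⟨n₁, e₁⟩ ⟨n₂, e₂⟩
    have hd : dist w₁ w₂ < 1 := by
      have := dist_triangle_right w₁ w₂ ν
      rw [Metric.mem_ball] at h₁ h₂
      linarith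
    have hsub : w₁ - w₂ = (((n₂ : ℤ) - n₁ : ℤ) : ℂ) := by push_cast; linear_combination e₁ - e₂
    rw [dist_eq_norm, hsub, Complex.norm_intCast] at hd
    have : (n₂ : ℤ) - n₁ = 0 := Int.abs_lt_one_iff.mp (by exact_mod_cast hd)
    rw [this] at hsub
    exact sub_eq_zero.mp (by simpa using hsub)
  have hball : ∀ᶠ w in 𝓝[≠] ν, w ∈ Metric.ball ν (1 / 2) :=
    mem_nhdsWithin_of_mem_nhds (Metric.ball_mem_nhds ν (by norm_num))
  by_cases h : ∃ w₀ ∈ Metric.ball ν (1 / 2), w₀ ≠ ν ∧ IsGammaPole (w₀ + s)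
  · obtain ⟨w₀, hw₀, hne, hp⟩ := h
    have h2 : ∀ᶠ w in 𝓝[≠] ν, w ≠ w₀ :=
      mem_nhdsWithin_of_mem_nhds (isOpen_ne.mem_nhds hne.symm)
    filter_upwards [hball, h2] with w hw hw2 hpw
    exact hw2 (huniq w hw w₀ hw₀ hpw hp)
  · filter_upwards [hball, self_mem_nhdsWithin] with w hw hwν hpw
    exact h ⟨w, hw, hwν, hpw⟩

lemma eventually_not_isGammaPole {s ν : ℂ} (h : ¬ IsGammaPole (ν + s)) :
    ∀ᶠ w in 𝓝 ν, ¬ IsGammaPole (w + s) := by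
  have h1 := eventually_not_isGammaPole_punctured s ν
  rw [eventually_nhdsWithin_iff] at h1
  filter_upwards [h1] with w hw
  by_cases hwν : w = ν
  · rwa [hwν]
  · exact hw hwν

lemma Gamma_eq_risingProd {ν : ℂ} (h : ¬ IsGammaPole (ν + 1)) (m : ℕ) :
    Complex.Gamma (ν + m + 1) = risingProd ν m * Complex.Gamma (ν + 1) := by
  induction m with
  | zero => simp [risingProd]
  | succ m ih =>
    have h0 : ν + 1 + m ≠ 0 := fun h0 => h ⟨m, by linear_combination h0⟩
    have e : ν + ((m + 1 : ℕ) : ℂ) + 1 = (ν + 1 + m) + 1 := by push_cast; ring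
    rw [e, Complex.Gamma_add_one _ h0, risingProd_succ]
    rw [show ν + (m : ℂ) + 1 = ν + 1 + m by ring] at ih
    rw [ih]
    ring

lemma Gamma_eq_fallingProd {ν : ℂ} (m : ℕ) (h : ¬ IsGammaPole (ν - m + 1)) :
    Complex.Gamma (ν + 1) = fallingProd ν m * Complex.Gamma (ν - m + 1) := by
  induction m with
  | zero => simp [fallingProd]
  | succ m ih =>
    push_cast at h ⊢
    have h1 : ν - (m + 1) + 1 = ν - m := by ring
    rw [h1] at h ⊢
    have h0 : ν - m ≠ 0 := by simpa using IsGammaPole.ne h 0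
    rw [ih fun ⟨n, hn⟩ => h ⟨n + 1, by push_cast; linear_combination hn⟩, fallingProd_succ,
      Complex.Gamma_add_one _ h0]
    ring

/-- The zeros of one product are `0, …, m - 1`, those of the other `-1, …, -m`. -/
lemma risingProd_ne_zero_of_fallingProd {ν : ℂ} {m : ℕ} (h : fallingProd ν m = 0) :
    risingProd ν m ≠ 0 := by
  obtain ⟨j, -, hj⟩ := Finset.prod_eq_zero_iff.mp h
  refine Finset.prod_ne_zero_iff.mpr fun i _ hi => ?_
  have : ((j + 1 + i : ℕ) : ℂ) = 0 := by push_cast; linear_combination hi - hj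
  rw [Nat.cast_eq_zero] at this
  omega

lemma differentiable_fallingProd (m : ℕ) : Differentiable ℂ fun ν => fallingProd ν m := by
  unfold fallingProd; fun_prop

lemma differentiable_risingProd (m : ℕ) : Differentiable ℂ fun ν => risingProd ν m := by
  unfold risingProd; fun_prop

/-- The factor `1 / (2 ^ (ν + 1) π i)`. -/
noncomputable def normFactor (ν : ℂ) : ℂ := 1 / ((2 : ℂ) ^ (ν + 1) * Real.pi * Complex.I)

lemma hasDerivAt_normFactor (ν : ℂ) :
    HasDerivAt normFactor (-Complex.log 2 * normFactor ν) ν := by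
  have h2 : (2 : ℂ) ^ (ν + 1) ≠ 0 := by simp
  have hpi : (Real.pi : ℂ) ≠ 0 := by exact_mod_cast Real.pi_ne_zero
  have h1 : HasDerivAt (fun ν : ℂ => (2 : ℂ) ^ (ν + 1) * Real.pi * Complex.I)
      ((2 : ℂ) ^ (ν + 1) * Complex.log 2 * 1 * Real.pi * Complex.I) ν :=
    (((((hasDerivAt_id ν).add_const 1).const_cpow (Or.inl two_ne_zero)).mul_const _).mul_const _)
  refine ((hasDerivAt_const ν (1 : ℂ)).div h1
    (mul_ne_zero (mul_ne_zero h2 hpi) Complex.I_ne_zero)).congr_deriv ?_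
  unfold normFactor
  field_simp
  ring

lemma hasDerivAt_Gamma {s : ℂ} (hs : ¬ IsGammaPole s) :
    HasDerivAt Complex.Gamma (Complex.digamma s * Complex.Gamma s) s := by
  have h := (Complex.differentiableAt_Gamma s (IsGammaPole.ne hs)).hasDerivAt
  have h0 := Complex.Gamma_ne_zero (IsGammaPole.ne hs)
  refine h.congr_deriv ?_
  rw [Complex.digamma_def, logDeriv_apply, div_mul_cancel₀ _ h0]

lemma hasDerivAt_prefactor {ν : ℂ} {a b : ℂ → ℂ} (ha : HasDerivAt a 1 ν) (hb : HasDerivAt b 1 ν)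
    (hpa : ¬ IsGammaPole (a ν)) (hpb : ¬ IsGammaPole (b ν)) :
    HasDerivAt (fun w => Complex.Gamma (a w) / Complex.Gamma (b w) * normFactor w)
      ((Complex.digamma (a ν) - Complex.digamma (b ν) - Complex.log 2) *
        (Complex.Gamma (a ν) / Complex.Gamma (b ν) * normFactor ν)) ν := by
  have h0 := Complex.Gamma_ne_zero (IsGammaPole.ne hpb)
  refine ((((hasDerivAt_Gamma hpa).comp ν ha).div ((hasDerivAt_Gamma hpb).comp ν hb) h0).mul
    (hasDerivAt_normFactor ν)).congr_deriv ?_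
  simp only [Function.comp_apply, Pi.div_apply]
  field_simp
  ring

/-! ### Power factors -/

lemma cpow_neg_half_mul_zpow {x : ℂ} (hx : x ≠ 0) (μ : ℤ) :
    x ^ (-(μ : ℂ) / 2) * x ^ μ = x ^ ((μ : ℂ) / 2) := by
  rw [← Complex.cpow_intCast, ← Complex.cpow_add _ _ hx]
  congr 1
  ring

lemma sqSubOnePow_neg_mul (hz : z - 1 ∈ Complex.slitPlane) (μ : ℤ) :
    sqSubOnePow z (-(μ : ℂ) / 2) * ((z - 1) * (z + 1)) ^ μ = sqSubOnePow z ((μ : ℂ) / 2) := by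
  unfold sqSubOnePow
  rw [← cpow_neg_half_mul_zpow (sub_one_ne_zero hz) μ,
    ← cpow_neg_half_mul_zpow (add_one_ne_zero hz) μ, mul_zpow]
  ring

lemma quotientPow_neg_mul (hz : z - 1 ∈ Complex.slitPlane) (μ : ℤ) :
    quotientPow z (-(μ : ℂ) / 2) * ((z - 1) / (z + 1)) ^ μ = quotientPow z ((μ : ℂ) / 2) := by
  unfold quotientPow
  rw [← cpow_neg_half_mul_zpow (sub_one_ne_zero hz) μ,
    ← cpow_neg_half_mul_zpow (add_one_ne_zero hz) μ, div_zpow]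
  rw [div_mul_div_comm]

lemma quotientPow_mul (hz : z - 1 ∈ Complex.slitPlane) (m : ℕ) :
    quotientPow z (((m : ℤ) : ℂ) / 2) * (z + 1) ^ m = sqSubOnePow z (((m : ℤ) : ℂ) / 2) := by
  have hz2 := add_one_ne_zero hz
  have h : (z + 1) ^ m = (z + 1) ^ (((m : ℤ) : ℂ) / 2) * (z + 1) ^ (((m : ℤ) : ℂ) / 2) := by
    rw [← Complex.cpow_add _ _ hz2, add_halves, Complex.cpow_intCast, zpow_natCast]
  have h0 : (z + 1) ^ (((m : ℤ) : ℂ) / 2) ≠ 0 := by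
    rw [Complex.cpow_def_of_ne_zero hz2]; exact Complex.exp_ne_zero _
  unfold quotientPow sqSubOnePow
  rw [h]
  field_simp

/-! ### The Legendre function as an entire function of the degree -/

/-- Schläfli's formula with a circle as the contour. -/
noncomputable def schlafliValue (c : ℂ) (R : ℝ) (ν : ℂ) (μ : ℤ) (z : ℂ) : ℂ :=
  Complex.Gamma (ν + μ + 1) / Complex.Gamma (ν + 1) * normFactor ν * sqSubOnePow z ((μ : ℂ) / 2) *
    ∮ t in C(c, R), schlafliKernel ν μ z t

/-- The formula by integrals over contours in the `u`-plane, with a circle as the contour. -/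
noncomputable def schendelValue (c : ℂ) (R : ℝ) (ν : ℂ) (μ : ℤ) (z : ℂ) : ℂ :=
  Complex.Gamma (ν + 1) / Complex.Gamma (ν - μ + 1) * normFactor ν * quotientPow z ((μ : ℂ) / 2) *
    ∮ t in C(c, R), schendelKernel ν μ z t

lemma exists_entire_of_nonneg (hz : z - 1 ∈ Complex.slitPlane) (hc : IsCommonCircle z c R)
    (m : ℕ) : ∃ E : ℂ → ℂ, Differentiable ℂ E ∧
      (∀ ν, ¬ IsGammaPole (ν + 1) → ¬ IsGammaPole (ν + (m : ℤ) + 1) →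
        schlafliValue c R ν m z = E ν) ∧
      ∀ ν, ¬ IsGammaPole (ν + 1) → ¬ IsGammaPole (ν - (m : ℤ) + 1) →
        schendelValue c R ν m z = E ν := by
  refine ⟨fun ν => risingProd ν m * normFactor ν * sqSubOnePow z (((m : ℤ) : ℂ) / 2) *
    ∮ t in C(c, R), schlafliKernel ν m z t, ?_, fun ν h1 h2 => ?_, fun ν h1 h2 => ?_⟩
  · refine (((differentiable_risingProd m).mul
      fun ν => (hasDerivAt_normFactor ν).differentiableAt).mul_const _).mul ?_
    exact fun ν => (hasDerivAt_circleIntegral_schlafliKernel hz hc ν m).differentiableAt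
  · have h0 := Complex.Gamma_ne_zero (IsGammaPole.ne h1)
    rw [schlafliValue, Int.cast_natCast, Gamma_eq_risingProd h1 m, mul_div_cancel_right₀ _ h0]
  · rw [Int.cast_natCast] at h2
    have h0 := Complex.Gamma_ne_zero (IsGammaPole.ne h2)
    have h := schendel_eq_schlafli hz hc ν m
    rw [schendelValue, ← quotientPow_mul hz, Gamma_eq_fallingProd m h2, Int.cast_natCast,
      mul_div_cancel_right₀ _ h0]
    linear_combination normFactor ν * quotientPow z ((m : ℂ) / 2) * h

lemma exists_entire_of_nonpos (hz : z - 1 ∈ Complex.slitPlane) (hc : IsCommonCircle z c R)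
    (m : ℕ) : ∃ E : ℂ → ℂ, Differentiable ℂ E ∧
      (∀ ν, ¬ IsGammaPole (ν + 1) → ¬ IsGammaPole (ν + (-(m : ℤ) : ℤ) + 1) →
        schlafliValue c R ν (-(m : ℤ)) z = E ν) ∧
      ∀ ν, ¬ IsGammaPole (ν + 1) → ¬ IsGammaPole (ν - (-(m : ℤ) : ℤ) + 1) →
        schendelValue c R ν (-(m : ℤ)) z = E ν := by
  classical
  set q := quotientPow z (((m : ℤ) : ℂ) / 2) with hq
  set A : ℂ → ℂ := fun ν => (fallingProd ν m)⁻¹ * normFactor ν * (q * (z + 1) ^ m) *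
    ∮ t in C(c, R), schlafliKernel ν m z t with hA
  set B : ℂ → ℂ := fun ν => (risingProd ν m)⁻¹ * normFactor ν * q *
    ∮ t in C(c, R), schendelKernel ν m z t with hB
  have hAB : ∀ ν, fallingProd ν m ≠ 0 → risingProd ν m ≠ 0 → A ν = B ν := by
    intro ν h1 h2
    have h := schendel_eq_schlafli hz hc ν m
    simp only [hA, hB]
    field_simp
    linear_combination -normFactor ν * q * h
  -- `A` is the Schläfli representation and may fail at zeros of `fallingProd`; `B`, the `u`-plane
  -- one, is regular there. They agree where both denominators are nonzero, so near any degree `E`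
  -- coincides with a differentiable one.
  set E : ℂ → ℂ := fun ν => if fallingProd ν m = 0 then B ν else A ν with hE
  have hEA : ∀ ν, fallingProd ν m ≠ 0 → E ν = A ν := fun ν h => if_neg h
  have hEB : ∀ ν, risingProd ν m ≠ 0 → E ν = B ν := by
    intro ν h
    by_cases h1 : fallingProd ν m = 0
    · exact if_pos h1
    · rw [hEA ν h1, hAB ν h1 h]
  have hN : ∀ ν, DifferentiableAt ℂ normFactor ν :=
    fun ν => (hasDerivAt_normFactor ν).differentiableAt
  refine ⟨E, fun ν => ?_, fun ν h1 h2 => ?_, fun ν h1 h2 => ?_⟩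
  · by_cases h : fallingProd ν m = 0
    · have h1 := risingProd_ne_zero_of_fallingProd h
      have hd : DifferentiableAt ℂ B ν :=
        (((((differentiable_risingProd m) ν).inv h1).mul (hN ν)).mul_const _).mul
          (hasDerivAt_circleIntegral_schendelKernel hz hc ν m).differentiableAt
      refine hd.congr_of_eventuallyEq ?_
      filter_upwards [(differentiable_risingProd m).continuous.continuousAt.eventually_ne h1]
        with w hw using hEB w hw
    · have hd : DifferentiableAt ℂ A ν :=
        (((((differentiable_fallingProd m) ν).inv h).mul (hN ν)).mul_const _).mul
          (hasDerivAt_circleIntegral_schlafliKernel hz hc ν m).differentiableAt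
      refine hd.congr_of_eventuallyEq ?_
      filter_upwards [(differentiable_fallingProd m).continuous.continuousAt.eventually_ne h]
        with w hw using hEA w hw
  · have e : ν + ((-(m : ℤ) : ℤ) : ℂ) + 1 = ν - m + 1 := by push_cast; ring
    rw [e] at h2
    have h3 := Gamma_eq_fallingProd m h2
    have h4 := Complex.Gamma_ne_zero (IsGammaPole.ne h1)
    have h5 := Complex.Gamma_ne_zero (IsGammaPole.ne h2)
    have h6 : fallingProd ν m ≠ 0 := fun h => h4 (by rw [h3, h, zero_mul])
    have h7 := sqSubOnePow_neg_mul hz m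
    rw [← quotientPow_mul hz m, ← hq] at h7
    have h8 : (((-(m : ℤ) : ℤ) : ℂ)) / 2 = -((m : ℤ) : ℂ) / 2 := by push_cast; ring
    rw [hEA ν h6, schlafliValue, circleIntegral_schlafliKernel_neg hz hc, h8, e, h3]
    simp only [hA]
    rw [← h7]
    field_simp
  · have e : ν - ((-(m : ℤ) : ℤ) : ℂ) + 1 = ν + m + 1 := by push_cast; ring
    rw [e] at h2
    have h3 := Gamma_eq_risingProd h1 m
    have h4 := Complex.Gamma_ne_zero (IsGammaPole.ne h1)
    have h5 := Complex.Gamma_ne_zero (IsGammaPole.ne h2)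
    have h6 : risingProd ν m ≠ 0 := fun h => h5 (by rw [h3, h, zero_mul])
    have h7 := quotientPow_neg_mul hz m
    rw [← hq] at h7
    have h8 : (((-(m : ℤ) : ℤ) : ℂ)) / 2 = -((m : ℤ) : ℂ) / 2 := by push_cast; ring
    rw [hEB ν h6, schendelValue, circleIntegral_schendelKernel_neg hz hc, h8, e, h3]
    simp only [hB]
    rw [← h7]
    field_simp

theorem exists_entire (hz : z - 1 ∈ Complex.slitPlane) (hc : IsCommonCircle z c R) {m : ℕ} {μ : ℤ}
    (hμ : μ = m ∨ μ = -m) : ∃ E : ℂ → ℂ, Differentiable ℂ E ∧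
      (∀ ν, ¬ IsGammaPole (ν + 1) → ¬ IsGammaPole (ν + μ + 1) → schlafliValue c R ν μ z = E ν) ∧
      ∀ ν, ¬ IsGammaPole (ν + 1) → ¬ IsGammaPole (ν - μ + 1) → schendelValue c R ν μ z = E ν := by
  rcases hμ with rfl | rfl
  · exact exists_entire_of_nonneg hz hc m
  · exact exists_entire_of_nonpos hz hc m

lemma eventually_regular (ν a : ℂ) :
    ∀ᶠ w in 𝓝[≠] ν, ¬ IsGammaPole (w + 1) ∧ ¬ IsGammaPole (w + a + 1) := by
  filter_upwards [eventually_not_isGammaPole_punctured 1 ν,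
    eventually_not_isGammaPole_punctured (a + 1) ν] with w h1 h2
  exact ⟨h1, by rwa [add_assoc]⟩

lemma eventually_regular_nhds {ν a : ℂ} (h1 : ¬ IsGammaPole (ν + 1))
    (h2 : ¬ IsGammaPole (ν + a + 1)) :
    ∀ᶠ w in 𝓝 ν, ¬ IsGammaPole (w + 1) ∧ ¬ IsGammaPole (w + a + 1) := by
  rw [add_assoc] at h2
  filter_upwards [eventually_not_isGammaPole h1, eventually_not_isGammaPole h2] with w h1 h2
  exact ⟨h1, by rwa [add_assoc]⟩

lemma schlafliFormula_eq (hz : z - 1 ∈ Complex.slitPlane) (hc : IsCommonCircle z c R)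
    {p : ℂ} {C : Path p p} (hC : IsContour z C) (ν : ℂ) (μ : ℤ) :
    schlafliFormula ν μ z = schlafliValue c R ν μ z := by
  have h : IsContour z (someContour z).2 :=
    -- The given contour `C` shows that the arbitrary choice in the definition really is a contour.
    Classical.epsilon_spec (p := fun C : (p : ℂ) × Path p p => IsContour z C.2) ⟨⟨p, C⟩, hC⟩
  rw [schlafliFormula, schlafliValue, normFactor,
    contourIntegral_eq_circleIntegral hz hc h (differentiableOn_schlafliKernel hz ν μ)]

lemma legendreP_eq (hz : z - 1 ∈ Complex.slitPlane) (hc : IsCommonCircle z c R)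
    {p : ℂ} {C : Path p p} (hC : IsContour z C) {μ : ℤ} {E : ℂ → ℂ} (hE : Continuous E)
    (h : ∀ ν, ¬ IsGammaPole (ν + 1) → ¬ IsGammaPole (ν + μ + 1) → schlafliValue c R ν μ z = E ν)
    (ν : ℂ) : legendreP ν μ z = E ν := by
  unfold legendreP
  split_ifs with hp
  · refine Tendsto.limUnder_eq ?_
    refine (hE.continuousAt.mono_left (nhdsWithin_le_nhds (s := {ν}ᶜ))).congr' ?_
    filter_upwards [eventually_regular ν μ] with w hw
    rw [schlafliFormula_eq hz hc hC, h w hw.1 hw.2]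
  · push Not at hp
    rw [schlafliFormula_eq hz hc hC, h ν hp.1 hp.2]

/-! ### The derivative with respect to the degree -/

/-- The first logarithm plus the transformed second one is `L + ln ((z + 1) / 2) - ln 2`. The `ln 2`
is cancelled by the derivative of `normFactor`, and the other constant by the term `-P ln ((z + 1) /
2)`. -/
lemma schlafli_log_sum (hz : z - 1 ∈ Complex.slitPlane) (hc : IsCommonCircle z c R) (ν : ℂ)
    (μ : ℤ) :
    (∮ t in C(c, R), schlafliKernel ν μ z t * Complex.log ((t + 1) / 2)) +
      (∮ t in C(c, R), schlafliKernel ν μ z t * (arcLog z t + Complex.log ((z + 1) / 2))) =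
      (∮ t in C(c, R), schlafliKernel ν μ z t * schlafliLog z t) +
        (Complex.log ((z + 1) / 2) - Complex.log 2) * ∮ t in C(c, R), schlafliKernel ν μ z t := by
  have hk := (differentiableOn_schlafliKernel hz ν μ).continuousOn.mono hc.mem_schlafli
  have hl := (differentiableOn_log_half (z := z)).continuousOn.mono hc.mem_schlafli
  have ha := (differentiableOn_arcLog hz).continuousOn.mono hc.mem_schlafli
  have hs : ContinuousOn (schlafliLog z) (Metric.sphere c R) := fun t ht =>
    (hasDerivAt_schlafliLog hz (hc.mem_schlafli t ht)).continuousAt.continuousWithinAt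
  have i₁ : CircleIntegrable (fun t => schlafliKernel ν μ z t * Complex.log ((t + 1) / 2)) c R :=
    (hk.mul hl).circleIntegrable hc.pos.le
  have i₂ : CircleIntegrable (fun t => schlafliKernel ν μ z t *
      (arcLog z t + Complex.log ((z + 1) / 2))) c R :=
    (hk.mul (ha.add continuousOn_const)).circleIntegrable hc.pos.le
  have i₃ : CircleIntegrable (fun t => schlafliKernel ν μ z t * schlafliLog z t) c R :=
    (hk.mul hs).circleIntegrable hc.pos.le
  have i₄ : CircleIntegrable (fun t => (Complex.log ((z + 1) / 2) - Complex.log 2) *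
      schlafliKernel ν μ z t) c R := (continuousOn_const.mul hk).circleIntegrable hc.pos.le
  rw [← circleIntegral.integral_const_mul, ← circleIntegral.integral_add i₁ i₂,
    ← circleIntegral.integral_add i₃ i₄]
  refine circleIntegral.integral_congr hc.pos.le fun t ht => ?_
  simp only [schlafliLog, log_div_two (schlafliDomain_add_one_ne_zero (hc.mem_schlafli t ht))]
  ring

lemma schendel_log_sum (hz : z - 1 ∈ Complex.slitPlane) (hc : IsCommonCircle z c R) (ν : ℂ)
    (μ : ℤ) :
    (∮ u in C(c, R), schendelKernel ν μ z u * (rayLog z u - Complex.log 2)) +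
      (∮ u in C(c, R), schendelKernel ν μ z u *
        (Complex.log ((u - 1) / (u - z)) + Complex.log ((z + 1) / 2))) =
      (∮ u in C(c, R), schendelKernel ν μ z u * schendelLog z u) +
        (Complex.log ((z + 1) / 2) - Complex.log 2) * ∮ u in C(c, R), schendelKernel ν μ z u := by
  have hk := (differentiableOn_schendelKernel hz ν μ).continuousOn.mono hc.mem_schendel
  have hl := (differentiableOn_rayLog hz).continuousOn.mono hc.mem_schendel
  have ha := (differentiableOn_log_quotient (z := z)).continuousOn.mono hc.mem_schendel
  have hs : ContinuousOn (schendelLog z) (Metric.sphere c R) := hl.add ha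
  have i₁ : CircleIntegrable (fun u => schendelKernel ν μ z u *
      (rayLog z u - Complex.log 2)) c R :=
    (hk.mul (hl.sub continuousOn_const)).circleIntegrable hc.pos.le
  have i₂ : CircleIntegrable (fun u => schendelKernel ν μ z u *
      (Complex.log ((u - 1) / (u - z)) + Complex.log ((z + 1) / 2))) c R :=
    (hk.mul (ha.add continuousOn_const)).circleIntegrable hc.pos.le
  have i₃ : CircleIntegrable (fun u => schendelKernel ν μ z u * schendelLog z u) c R :=
    (hk.mul hs).circleIntegrable hc.pos.le
  have i₄ : CircleIntegrable (fun u => (Complex.log ((z + 1) / 2) - Complex.log 2) *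
      schendelKernel ν μ z u) c R := (continuousOn_const.mul hk).circleIntegrable hc.pos.le
  rw [← circleIntegral.integral_const_mul, ← circleIntegral.integral_add i₁ i₂,
    ← circleIntegral.integral_add i₃ i₄]
  refine circleIntegral.integral_congr hc.pos.le fun u _ => ?_
  simp only [schendelLog]
  ring

theorem hasDerivAt_firstRHS (hz : z - 1 ∈ Complex.slitPlane) (hc : IsCommonCircle z c R)
    {p : ℂ} {C : Path p p} (hC : IsContour z C) {μ : ℤ} {ν : ℂ} (h1 : ¬ IsGammaPole (ν + 1))
    (h2 : ¬ IsGammaPole (ν + μ + 1)) (hP : legendreP ν μ z = schlafliValue c R ν μ z) :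
    HasDerivAt (fun w => schlafliValue c R w μ z) (firstRHS C ν μ z) ν := by
  have ha : HasDerivAt (fun w : ℂ => w + μ + 1) 1 ν :=
    ((hasDerivAt_id ν).add_const _).add_const _
  have hb : HasDerivAt (fun w : ℂ => w + 1) 1 ν := (hasDerivAt_id ν).add_const _
  refine (((hasDerivAt_prefactor ha hb h2 h1).mul_const (sqSubOnePow z ((μ : ℂ) / 2))).mul
    (hasDerivAt_circleIntegral_schlafliKernel hz hc ν μ)).congr_deriv ?_
  rw [firstRHS, hP, schlafliValue, ← normFactor,
    contourIntegral_eq_circleIntegral hz hc hC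
      (f := fun t => schlafliKernel ν μ z t * Complex.log ((t + 1) / 2))
      ((differentiableOn_schlafliKernel hz ν μ).mul differentiableOn_log_half),
    contourIntegral_eq_circleIntegral hz hc hC
      (f := fun t => schlafliKernel ν (-μ) z t * Complex.log ((t + 1) / 2))
      ((differentiableOn_schlafliKernel hz ν (-μ)).mul differentiableOn_log_half),
    circleIntegral_schlafliKernel_neg_log hz hc, ← sqSubOnePow_neg_mul hz μ]
  have h := schlafli_log_sum hz hc ν μ
  linear_combination -(Complex.Gamma (ν + μ + 1) / Complex.Gamma (ν + 1) * normFactor ν *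
    (sqSubOnePow z (-(μ : ℂ) / 2) * ((z - 1) * (z + 1)) ^ μ)) * h

theorem hasDerivAt_secondRHS (hz : z - 1 ∈ Complex.slitPlane) (hc : IsCommonCircle z c R)
    {p : ℂ} {C : Path p p} (hC : IsContour' z C) {μ : ℤ} {ν : ℂ} (h1 : ¬ IsGammaPole (ν + 1))
    (h2 : ¬ IsGammaPole (ν - μ + 1)) (hP : legendreP ν μ z = schendelValue c R ν μ z) :
    HasDerivAt (fun w => schendelValue c R w μ z) (secondRHS C ν μ z) ν := by
  have ha : HasDerivAt (fun w : ℂ => w - μ + 1) 1 ν :=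
    ((hasDerivAt_id ν).sub_const _).add_const _
  have hb : HasDerivAt (fun w : ℂ => w + 1) 1 ν := (hasDerivAt_id ν).add_const _
  refine (((hasDerivAt_prefactor hb ha h1 h2).mul_const (quotientPow z ((μ : ℂ) / 2))).mul
    (hasDerivAt_circleIntegral_schendelKernel hz hc ν μ)).congr_deriv ?_
  have hlog := (differentiableOn_rayLog hz).sub_const (Complex.log 2)
  rw [secondRHS, hP, schendelValue, ← normFactor,
    contourIntegral_eq_circleIntegral' hz hc hC
      (f := fun u => schendelKernel ν μ z u * (rayLog z u - Complex.log 2))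
      ((differentiableOn_schendelKernel hz ν μ).mul hlog),
    contourIntegral_eq_circleIntegral' hz hc hC
      (f := fun u => schendelKernel ν (-μ) z u * (rayLog z u - Complex.log 2))
      ((differentiableOn_schendelKernel hz ν (-μ)).mul hlog),
    circleIntegral_schendelKernel_neg_log hz hc, ← quotientPow_neg_mul hz μ]
  have h := schendel_log_sum hz hc ν μ
  linear_combination -(Complex.Gamma (ν + 1) / Complex.Gamma (ν - μ + 1) * normFactor ν *
    (quotientPow z (-(μ : ℂ) / 2) * ((z - 1) / (z + 1)) ^ μ)) * h

end Legendre

/-! ### Both formulas at regular degrees and their limits at all degrees -/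

theorem mainTheorem1 (z : ℂ) (hz : z - 1 ∈ Complex.slitPlane)
    (m : ℕ) (μ : ℤ) (hμ : μ = m ∨ μ = -m)
    (p : ℂ) (C : Path p p) (hC : Legendre.IsContour z C)
    (p' : ℂ) (C' : Path p' p') (hC' : Legendre.IsContour' z C')
    (ν : ℂ) :
    ∃ d : ℂ,
      HasDerivAt (fun w => Legendre.legendreP w μ z) d ν ∧
      (¬ Legendre.IsGammaPole (ν + 1) → ¬ Legendre.IsGammaPole (ν + μ + 1) →
        d = Legendre.firstRHS C ν μ z) ∧
      Filter.Tendsto (fun w => Legendre.firstRHS C w μ z) (nhdsWithin ν {ν}ᶜ) (nhds d) ∧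
      (¬ Legendre.IsGammaPole (ν + 1) → ¬ Legendre.IsGammaPole (ν - μ + 1) →
        d = Legendre.secondRHS C' ν μ z) ∧
      Filter.Tendsto (fun w => Legendre.secondRHS C' w μ z) (nhdsWithin ν {ν}ᶜ) (nhds d) := by
  obtain ⟨c, R, hc⟩ := Legendre.exists_isCommonCircle hz
  obtain ⟨E, hE, hS, hT⟩ := Legendre.exists_entire hz hc hμ
  have hP := Legendre.legendreP_eq hz hc hC hE.continuous hS
  have hfirst : ∀ w, ¬ Legendre.IsGammaPole (w + 1) → ¬ Legendre.IsGammaPole (w + μ + 1) →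
      deriv E w = Legendre.firstRHS C w μ z := by
    intro w h1 h2
    refine ((Legendre.hasDerivAt_firstRHS hz hc hC h1 h2
      ((hP w).trans (hS w h1 h2).symm)).congr_of_eventuallyEq ?_).deriv
    filter_upwards [Legendre.eventually_regular_nhds h1 h2] with x hx
    exact (hS x hx.1 hx.2).symm
  have hsecond : ∀ w, ¬ Legendre.IsGammaPole (w + 1) → ¬ Legendre.IsGammaPole (w - μ + 1) →
      deriv E w = Legendre.secondRHS C' w μ z := by
    intro w h1 h2
    refine ((Legendre.hasDerivAt_secondRHS hz hc hC' h1 h2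
      ((hP w).trans (hT w h1 h2).symm)).congr_of_eventuallyEq ?_).deriv
    rw [sub_eq_add_neg] at h2
    filter_upwards [Legendre.eventually_regular_nhds h1 h2] with x hx
    exact (hT x hx.1 (by rw [sub_eq_add_neg]; exact hx.2)).symm
  -- Exceptional degrees are isolated: near `ν` each right-hand side equals `deriv E`, so the limit
  -- is the value of a continuous function.
  have hcont : Tendsto (deriv E) (𝓝[≠] ν) (𝓝 (deriv E ν)) :=
    (hE.contDiff (n := 1)).continuous_deriv_one.continuousAt.mono_left nhdsWithin_le_nhds
  refine ⟨deriv E ν, ?_, hfirst ν, hcont.congr' ?_, hsecond ν, hcont.congr' ?_⟩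
  · rw [funext hP]
    exact (hE ν).hasDerivAt
  · filter_upwards [Legendre.eventually_regular ν μ] with w hw using hfirst w hw.1 hw.2
  · filter_upwards [Legendre.eventually_regular ν (-μ)] with w hw
    exact hsecond w hw.1 (by rw [sub_eq_add_neg]; exact hw.2)
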